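/- **Conventions.** Order $\mathbb{Z}[x]$ by $f>0$ iff the leading coefficient of $f$ is positive; put $P[x]=\{f\in\mathbb{Z}[x]\mid f\ge 0\}$ and $P[x]^*=P[x]\setminus\{0\}$. An affine $P[x]$-semimodule is a set $S=\{\sum_i g_iu_i\mid g_i\in P[x]\}\subseteq\mathbb{Z}[x]^n$ with finitely many generators $u_i$; $S^{md}$ is the $\mathbb{Z}[x]$-module generated by $S$, and $\operatorname{rank}S$ is the rank of $S^{md}$. $S$ is *pointed* if $S\cap(-S)=\{0\}$. A *face* $F$ of $S$ is a $P[x]$-subsemimodule such that ($u,v\in S$, $u+v\in F$ imply $u,v\in F$) and ($g\in P[x]^*$, $u\in S$, $gu\in F$ imply $u\in F$); a *facet* is a face of rank $\operatorname{rank}S-1$. The *standard normal vector* $\varphi_F$ of a facet $F$ of $S$ is the element of $N=\operatorname{Hom}_{\mathbb{Z}[x]}(S^{md},\mathbb{Z}[x])$ that is $\ge 0$ on $S$ and whose nonzero multiples are exactly the $\varphi\in N$ with $F=S\cap\ker\varphi$. $S$ is *smooth* if $\{\varphi_F\mid F\text{ a facet of }S\}$ is a basis of $N$. A *fan* $\Sigma$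 is a finite collection of affine $P[x]$-semimodules $S_i\subseteq\mathbb{Z}[x]^n$ such that: all $S_i^{md}$ equal one lattice $\Sigma^{md}$; for $i\ne j$ there is $u\in S_i$ with $-u\in S_j$ and $S_i+\mathbb{Z}[x](-u)=S_j+\mathbb{Z}[x]u$; and for distinct $i,j,l$, if $u,v,w$ are such elements for the pairs $(i,j),(j,l),(l,i)$, then $S_i+\mathbb{Z}[x](-u)+\mathbb{Z}[x]w=S_j+\mathbb{Z}[x]u+\mathbb{Z}[x](-v)=S_l+\mathbb{Z}[x]v+\mathbb{Z}[x](-w)$. $\Sigma$ is *smooth* if every $S_i$ is smooth. Let $k$ be a field of characteristic $0$ with an endomorphism $\sigma$. On the semimodule algebra $k[S]=\bigoplus_{u\in S}k\chi^u$ put $\sigma(c\chi^u)=\sigma(c)\chi^{xu}$. $\operatorname{Spec}^{P[\sigma]}(k[S])$ is the set of prime ideals $I$ with $\sigma(I)\subseteq I$ which are perfect ($\prod_i\sigma^i(a)^{c_i}\in I$ for some $0\neq\sum_i c_ix^i\in\mathbb{N}[x]$ implies $a\in I$) and satisfy $\chi^uf\in I\Rightarrow\chi^{gu}f\in I$ for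 $g\in P[x]^*$; its closed sets are the sets $\{I\mid B\subseteq I\}$, $B\subseteq k[S]$. For a face $F$ of $S$, $D(F)$ is the set of those $I$ that contain $\chi^u$ for all $u\in S\setminus F$. The toric $P[\sigma]$-variety $X_\Sigma$ is glued from the $X_i=\operatorname{Spec}^{P[\sigma]}(k[S_i])$ along the open subsets $\operatorname{Spec}^{P[\sigma]}(k[S_i+\mathbb{Z}[x](-u)])=\operatorname{Spec}^{P[\sigma]}(k[S_j+\mathbb{Z}[x]u])$, $u$ as above. Facets $F$ of $S_i$ and $G$ of $S_j$ are equivalent if, with $u$ as above, $F^{md}=G^{md}=H^{md}$ for some face $H$ of $S_i+\mathbb{Z}[x](-u)$. Each equivalence class $L$ gives a *prime divisor* $D_L\subseteq X_\Sigma$, glued from the $D(F)$, $F\in L$, and a vector $\varphi_L=\varphi_F\in\operatorname{Hom}(\Sigma^{md},\mathbb{Z}[x])$, $F\in L$. $\operatorname{Div}(X_\Sigma)$ is the free $\mathbb{Z}[x]$-module on the $D_L$; for $u\in\Sigma^{md}$ let $\operatorname{div}(\chi^u)=\sum_L\varphi_L(u)D_L$, and let $\operatorname{Div}_c$ be the submodule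 of all $\operatorname{div}(\chi^u)$. For $U\subseteq X_\Sigma$ open, $(\sum_La_LD_L)|_U=\sum_{D_L\cap U\ne\emptyset}a_L(D_L\cap U)$. $D\in\operatorname{Div}(X_\Sigma)$ is *Cartier* if $X_\Sigma$ has an open cover by sets $U$ on each of which $D|_U=\operatorname{div}(\chi^u)|_U$ for some $u\in\Sigma^{md}$. The Cartier divisors form a submodule $\operatorname{CDiv}$. Put $\operatorname{Cl}(X_\Sigma)=\operatorname{Div}/\operatorname{Div}_c$ and $\operatorname{Pic}(X_\Sigma)=\operatorname{CDiv}/\operatorname{Div}_c$; $X_\Sigma$ is *smooth* if $\operatorname{Cl}(X_\Sigma)=\operatorname{Pic}(X_\Sigma)$, i.e. the natural embedding $\operatorname{Pic}\to\operatorname{Cl}$ is an isomorphism. **Theorem.** Let $\Sigma$ be a fan such that $M=\Sigma^{md}$ is a free $\mathbb{Z}[x]$-module. If $\Sigma$ is smooth, then $X_\Sigma$ is smooth. If moreover every $S\in\Sigma$ is pointed (which is only needed for the converse), then $X_\Sigma$ is smooth if and only if $\Sigma$ is smooth. -/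

import Mathlib

open Polynomial

noncomputable section

namespace ToricP

/-! ### The ordered ring `ℤ[x]` and `P[x]`-semimodules -/

/-- `f ≥ 0` for the total order on `ℤ[x]` that compares coefficients from the top degree down:
this means that the leading coefficient of `f` is nonnegative. -/
def IsNonneg (f : ℤ[X]) : Prop := 0 ≤ f.leadingCoeff

theorem IsNonneg.add {f g : ℤ[X]} (hf : IsNonneg f) (hg : IsNonneg g) : IsNonneg (f + g) := by
  unfold IsNonneg at *
  rcases lt_trichotomy f.degree g.degree with h | h | h
  · rwa [leadingCoeff_add_of_degree_lt h]
  · by_cases hs : f.leadingCoeff + g.leadingCoeff = 0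
    · have h1 : f.leadingCoeff = 0 := by linarith
      have h2 : g.leadingCoeff = 0 := by linarith
      rw [leadingCoeff_eq_zero] at h1 h2
      simp [h1, h2]
    · rw [leadingCoeff_add_of_degree_eq h hs]
      exact add_nonneg hf hg
  · rwa [leadingCoeff_add_of_degree_lt' h]

/-- The semiring `P[x] = {f ∈ ℤ[x] | f ≥ 0}`. -/
def PX : Subsemiring ℤ[X] where
  carrier := {f | IsNonneg f}
  mul_mem' := by
    intro f g hf hg
    change 0 ≤ (f * g).leadingCoeff
    rw [leadingCoeff_mul]
    exact mul_nonneg hf hg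
  one_mem' := by simp [IsNonneg]
  add_mem' := fun hf hg => IsNonneg.add hf hg
  zero_mem' := by simp [IsNonneg]

/-- The indeterminate `x` as an element of `P[x]`. -/
def xP : PX := ⟨X, by change 0 ≤ (X : ℤ[X]).leadingCoeff; simp⟩

/-- The `ℤ[x]`-module `ℤ[x]^n`. -/
abbrev Amb (n : ℕ) := Fin n → ℤ[X]

/-- `P[x]`-semimodules in `ℤ[x]^n`. The affine ones are those with `S.FG`. -/
abbrev Semi (n : ℕ) := Submodule PX (Amb n)

variable {n : ℕ}

/-- `S^md`, the `ℤ[x]`-lattice generated by `S`. -/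
def md (S : Semi n) : Submodule ℤ[X] (Amb n) := Submodule.span ℤ[X] (S : Set (Amb n))

/-- `rank S = rank S^md`. -/
def rank (S : Semi n) : ℕ := Module.finrank ℤ[X] (md S)

/-- `S` is pointed: `S ∩ (-S) = {0}`. -/
def IsPointed (S : Semi n) : Prop := ∀ u ∈ S, -u ∈ S → u = 0

/-- `F` is a face of `S`. -/
structure IsFace (S F : Semi n) : Prop where
  le : F ≤ S
  add_mem : ∀ u ∈ S, ∀ v ∈ S, u + v ∈ F → u ∈ F ∧ v ∈ F
  smul_mem : ∀ g : PX, g ≠ 0 → ∀ u ∈ S, g • u ∈ F → u ∈ F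

/-- The facets of `S`: the faces of rank `rank S - 1`. -/
def Facet (S : Semi n) : Type := {F : Semi n // IsFace S F ∧ rank F + 1 = rank S}

/-- A finitely generated `P[x]`-semimodule has only finitely many faces, because a face is generated
by the generators that it contains. -/
theorem finite_faces {S : Semi n} (hS : S.FG) : {F : Semi n | IsFace S F}.Finite := by
  obtain ⟨U, hU⟩ := hS
  have key : ∀ F : Semi n, IsFace S F →
      F = Submodule.span PX ((U : Set (Amb n)) ∩ (F : Set (Amb n))) := by
    intro F hF
    apply le_antisymm
    · intro w hw
      have hwS : w ∈ Submodule.span PX (U : Set (Amb n)) := hU ▸ hF.le hw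
      revert hw
      induction hwS using Submodule.span_induction with
      | mem w h => exact fun hw => Submodule.subset_span ⟨h, hw⟩
      | zero => exact fun _ => Submodule.zero_mem _
      | add a b ha hb iha ihb =>
        intro hw
        obtain ⟨h1, h2⟩ := hF.add_mem a (hU ▸ ha) b (hU ▸ hb) hw
        exact Submodule.add_mem _ (iha h1) (ihb h2)
      | smul g a ha iha =>
        intro hw
        by_cases hg : g = 0
        · rw [hg, zero_smul]
          exact Submodule.zero_mem _
        · exact Submodule.smul_mem _ _ (iha (hF.smul_mem g hg a (hU ▸ ha) hw))
    · exact Submodule.span_le.2 Set.inter_subset_right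
  refine Set.Finite.subset ((U.finite_toSet.powerset).image (fun A => Submodule.span PX A)) ?_
  intro F hF
  exact ⟨(U : Set (Amb n)) ∩ (F : Set (Amb n)), Set.inter_subset_left, (key F hF).symm⟩

theorem finite_facet {S : Semi n} (hS : S.FG) : Finite (Facet S) :=
  ((finite_faces hS).subset (fun _ h => h.1 : {F : Semi n | IsFace S F ∧ rank F + 1 = rank S} ⊆ _)).to_subtype

/-- `V(F)`: the `φ ∈ N = Hom(S^md, ℤ[x])` with `F = H_φ ∩ S`, where `H_φ` is the kernel of `φ`. -/
def V (S F : Semi n) : Set (md S →ₗ[ℤ[X]] ℤ[X]) :=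
  {φ | ∀ u : md S, (u : Amb n) ∈ F ↔ φ u = 0 ∧ (u : Amb n) ∈ S}

/-- `φ` is a standard normal vector of the facet `F` of `S`: the elements of `V(F)` are exactly the
nonzero multiples of `φ`, and `φ ≥ 0` on `S`. -/
structure IsStdNormal (S F : Semi n) (φ : md S →ₗ[ℤ[X]] ℤ[X]) : Prop where
  mem_iff : ∀ ψ, ψ ∈ V S F ↔ ∃ c : ℤ[X], c ≠ 0 ∧ ψ = c • φ
  nonneg : ∀ u : md S, (u : Amb n) ∈ S → IsNonneg (φ u)

open Classical in
/-- The standard normal vector `φ_F` of a facet `F` of `S`. -/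
def stdNormal (S : Semi n) (F : Facet S) : md S →ₗ[ℤ[X]] ℤ[X] :=
  if h : ∃ φ, IsStdNormal S F.1 φ then h.choose else 0

/-- `S` is smooth: the standard normal vectors of its facets form a basis of `Hom(S^md, ℤ[x])`. -/
def IsSmooth (S : Semi n) : Prop :=
  LinearIndependent ℤ[X] (stdNormal S) ∧ Submodule.span ℤ[X] (Set.range (stdNormal S)) = ⊤

/-! ### Fans -/

/-- `S + ℤ[x] u`. -/
def adj (S : Semi n) (u : Amb n) : Semi n :=
  S ⊔ (Submodule.span ℤ[X] {u}).restrictScalars PX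

theorem le_adj (S : Semi n) (u : Amb n) : S ≤ adj S u := le_sup_left

/-- `u ∈ S`, `-u ∈ T` and `S + ℤ[x](-u) = T + ℤ[x]u`. -/
structure Glue (S T : Semi n) (u : Amb n) : Prop where
  mem_left : u ∈ S
  mem_right : -u ∈ T
  eq : adj S (-u) = adj T u

theorem Glue.le_right {S T : Semi n} {u : Amb n} (h : Glue S T u) : T ≤ adj S (-u) :=
  h.eq ▸ le_adj T u

/-- A fan: a finite compatible collection of affine `P[x]`-semimodules in `ℤ[x]^n`, indexed by `ι`;
`lattice` is `Σ^md`. -/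
structure Fan (n : ℕ) (ι : Type*) [Finite ι] where
  S : ι → Semi n
  fg : ∀ i, (S i).FG
  lattice : Submodule ℤ[X] (Amb n)
  md_eq : ∀ i, md (S i) = lattice
  compat : ∀ i j, i ≠ j → ∃ u, Glue (S i) (S j) u
  cocycle : ∀ i j l, i ≠ j → j ≠ l → l ≠ i → ∀ u v w,
    Glue (S i) (S j) u → Glue (S j) (S l) v → Glue (S l) (S i) w →
      adj (adj (S i) (-u)) w = adj (adj (S j) u) (-v) ∧
      adj (adj (S j) u) (-v) = adj (adj (S l) v) (-w)

/-- A fan is smooth if all its members are. -/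
def Fan.IsSmooth {ι : Type*} [Finite ι] (A : Fan n ι) : Prop := ∀ i, ToricP.IsSmooth (A.S i)

/-! ### Affine toric `P[σ]`-varieties -/

section Affine

variable {k : Type*} [Field k] (σ : k →+* k)

/-- The semimodule algebra `k[S]`; the character `χ^u` is `AddMonoidAlgebra.single u 1`. -/
abbrev Alg (k : Type*) [Field k] (S : Semi n) := AddMonoidAlgebra k S

/-- The character `χ^u`, `u ∈ S`. -/
def chi (k : Type*) [Field k] {S : Semi n} (u : S) : Alg k S := AddMonoidAlgebra.single u 1

/-- The difference operator of `k[S]`: `σ(c χ^u) = σ(c) χ^{xu}`. -/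
def sig (S : Semi n) : Alg k S →+* Alg k S :=
  (AddMonoidAlgebra.mapDomainRingHom k (DistribSMul.toAddMonoidHom S xP)).comp
    (AddMonoidAlgebra.mapRingHom S σ)

/-- The inclusion `k[S] ⊆ k[T]` for `S ⊆ T`. -/
def incl (k : Type*) [Field k] {S T : Semi n} (h : S ≤ T) : Alg k S →+* Alg k T :=
  AddMonoidAlgebra.mapDomainRingHom k (Submodule.inclusion h).toAddMonoidHom

/-- `P[σ]`-prime ideals of `k[S]`: prime ideals that are `σ`-ideals, perfect (`a^g ∈ I` implies
`a ∈ I` for `0 ≠ g ∈ ℕ[x]`, where `a^g = ∏ σ^i(a)^{g_i}`), and closed under `χ^u f ↦ χ^{gu} f` for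
nonzero `g ∈ P[x]`. -/
structure IsPSigmaPrime {S : Semi n} (I : Ideal (Alg k S)) : Prop where
  prime : I.IsPrime
  sigma_mem : ∀ a ∈ I, sig σ S a ∈ I
  perfect : ∀ (g : ℕ[X]) (a : Alg k S), g ≠ 0 →
    (∏ i ∈ g.support, ((sig σ S)^[i] a) ^ g.coeff i) ∈ I → a ∈ I
  smul_mem : ∀ (g : PX) (u : S) (f : Alg k S), g ≠ 0 → chi k u * f ∈ I → chi k (g • u) * f ∈ I

/-- `Spec^{P[σ]}(k[S])`, the (topological space of the) affine toric `P[σ]`-variety of `S`. As a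
subspace of the prime spectrum its closed sets are the `{p | B ⊆ p}` for `B ⊆ k[S]`. -/
abbrev PSpec (S : Semi n) := {p : PrimeSpectrum (Alg k S) // IsPSigmaPrime σ p.asIdeal}

/-- The subvariety `D(F)` of `Spec^{P[σ]}(k[S])` defined by the ideal `k[S \ F]`, for a face `F`. -/
def faceVar (S F : Semi n) : Set (PSpec σ S) :=
  {p | ∀ u : S, (u : Amb n) ∉ F → chi k u ∈ p.1.asIdeal}

end Affine

/-! ### The toric `P[σ]`-variety of a fan and its divisors -/

namespace Fan

section Variety

variable {ι : Type*} [Finite ι] {k : Type*} [Field k] (σ : k →+* k) (A : Fan n ι)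

/-- The gluing of the affine pieces: the open subsets `χ^u ≠ 0` of `Spec^{P[σ]}(k[S_i])` and
`χ^{-u} ≠ 0` of `Spec^{P[σ]}(k[S_j])` are both identified, by restricting prime ideals, with the
spectrum of `k[S_i]_{χ^u} = k[S_i + ℤ[x](-u)] = k[S_j + ℤ[x]u] = k[S_j]_{χ^{-u}}`. -/
def GlueRel (p q : Σ i, PSpec σ (A.S i)) : Prop :=
  ∃ (u : Amb n) (h : Glue (A.S p.1) (A.S q.1) u) (r : PSpec σ (adj (A.S p.1) (-u))),
    p.2.1.asIdeal = r.1.asIdeal.comap (incl k (le_adj (A.S p.1) (-u))) ∧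
    q.2.1.asIdeal = r.1.asIdeal.comap (incl k h.le_right)

/-- (The topological space of) the toric `P[σ]`-variety `X_Σ`, with the quotient topology of the
disjoint union of the affine pieces. -/
def Var : Type _ := Quot (A.GlueRel σ)

instance : TopologicalSpace (A.Var σ) := inferInstanceAs (TopologicalSpace (Quot (A.GlueRel σ)))

/-- The chart `Spec^{P[σ]}(k[S_i]) → X_Σ`. -/
def chart (i : ι) (p : PSpec σ (A.S i)) : A.Var σ := Quot.mk _ ⟨i, p⟩

/-- The set `F_Σ(1)` of all facets of members of the fan; a facet is taken together with the member
that it belongs to. -/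
def Facets : Type _ := Σ i, Facet (A.S i)

/-- The relation `∼` on `F_Σ(1)`. -/
def FacetRel (F G : A.Facets) : Prop :=
  ∃ u, Glue (A.S F.1) (A.S G.1) u ∧
    ∃ H, IsFace (adj (A.S F.1) (-u)) H ∧ md F.2.1 = md G.2.1 ∧ md G.2.1 = md H

/-- `L_Σ(1) = F_Σ(1)/∼`, the index set of the prime divisors. -/
def Rays : Type _ := Quot A.FacetRel

instance : Finite A.Rays := by
  have : ∀ i, Finite (Facet (A.S i)) := fun i => finite_facet (A.fg i)
  have : Finite A.Facets := inferInstanceAs (Finite (Σ i, Facet (A.S i)))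
  exact inferInstanceAs (Finite (Quot A.FacetRel))

/-- The prime divisor `D_L` of `X_Σ`: the subvariety glued from the `D(F)`, `F ∈ L`. -/
def primeDiv (L : A.Rays) : Set (A.Var σ) :=
  {P | ∃ F : A.Facets, Quot.mk _ F = L ∧ ∃ p ∈ faceVar σ (A.S F.1) F.2.1, A.chart σ F.1 p = P}

/-- `φ_L ∈ Hom(Σ^md, ℤ[x])`: the standard normal vector of a representative of `L`. -/
def rayNormal (L : A.Rays) : A.lattice →ₗ[ℤ[X]] ℤ[X] :=
  (stdNormal (A.S (Quot.out L).1) (Quot.out L).2).comp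
    (LinearEquiv.ofEq _ _ (A.md_eq (Quot.out L).1).symm).toLinearMap

/-- `Div(X_Σ)`: the free `ℤ[x]`-module on the prime divisors. -/
def Weil := A.Rays →₀ ℤ[X]

instance : AddCommGroup A.Weil := inferInstanceAs (AddCommGroup (A.Rays →₀ ℤ[X]))

instance : Module ℤ[X] A.Weil := inferInstanceAs (Module ℤ[X] (A.Rays →₀ ℤ[X]))

/-- The divisor `div(χ^u) = ∑_L φ_L(u) D_L` of a character, `u ∈ Σ^md`. -/
def divChar : A.lattice →ₗ[ℤ[X]] A.Weil :=
  (Finsupp.linearEquivFunOnFinite ℤ[X] ℤ[X] A.Rays).symm.toLinearMap.comp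
    (LinearMap.pi A.rayNormal)

/-- `Div_c(X_Σ)`: the characteristic divisors. -/
def charDivs : Submodule ℤ[X] A.Weil := LinearMap.range A.divChar

/-- The restriction `D|_U = ∑_{D_L ∩ U ≠ ∅} a_L (D_L ∩ U)` of a Weil divisor `D = ∑_L a_L D_L`, as a
formal sum indexed by the prime divisors that meet `U`. -/
def restrict (U : Set (A.Var σ)) :
    A.Weil →ₗ[ℤ[X]] ({L : A.Rays // (A.primeDiv σ L ∩ U).Nonempty} →₀ ℤ[X]) :=
  Finsupp.lsubtypeDomain {L : A.Rays | (A.primeDiv σ L ∩ U).Nonempty}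

/-- `D` is Cartier: `X_Σ` has an open cover on each member of which `D` agrees with the divisor of a
character. -/
def IsCartier (D : A.Weil) : Prop :=
  ∃ C : Set (Set (A.Var σ)), (∀ U ∈ C, IsOpen U) ∧ ⋃₀ C = Set.univ ∧
    ∀ U ∈ C, ∃ u : A.lattice, A.restrict σ U D = A.restrict σ U (A.divChar u)

/-- Agreement after restriction passes to smaller sets. -/
theorem restrict_mono {U W : Set (A.Var σ)} (h : U ⊆ W) {D E : A.Weil}
    (hD : A.restrict σ W D = A.restrict σ W E) : A.restrict σ U D = A.restrict σ U E := by
  ext1 ⟨L, hL⟩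
  exact DFunLike.congr_fun hD ⟨L, hL.mono (Set.inter_subset_inter_right _ h)⟩

/-- `CDiv(X_Σ)`: the Cartier divisors. -/
def CDiv : Submodule ℤ[X] A.Weil where
  carrier := {D | A.IsCartier σ D}
  zero_mem' := ⟨{Set.univ}, by simp, by simp, fun U _ => ⟨0, by simp⟩⟩
  add_mem' := by
    rintro D E ⟨C, hC, hCu, hCd⟩ ⟨C', hC', hCu', hCd'⟩
    refine ⟨Set.image2 (· ∩ ·) C C', ?_, ?_, ?_⟩
    · rintro _ ⟨U, hU, W, hW, rfl⟩
      exact (hC U hU).inter (hC' W hW)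
    · refine Set.eq_univ_of_forall fun P => ?_
      obtain ⟨U, hU, hP⟩ : P ∈ ⋃₀ C := hCu ▸ Set.mem_univ P
      obtain ⟨W, hW, hP'⟩ : P ∈ ⋃₀ C' := hCu' ▸ Set.mem_univ P
      exact ⟨U ∩ W, ⟨U, hU, W, hW, rfl⟩, hP, hP'⟩
    · rintro _ ⟨U, hU, W, hW, rfl⟩
      obtain ⟨u, hu⟩ := hCd U hU
      obtain ⟨v, hv⟩ := hCd' W hW
      refine ⟨u + v, ?_⟩
      rw [map_add, map_add, map_add, A.restrict_mono σ Set.inter_subset_left hu,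
        A.restrict_mono σ Set.inter_subset_right hv]
  smul_mem' := by
    rintro g D ⟨C, hC, hCu, hCd⟩
    refine ⟨C, hC, hCu, fun U hU => ?_⟩
    obtain ⟨u, hu⟩ := hCd U hU
    exact ⟨g • u, by rw [map_smul, map_smul, map_smul, hu]⟩

/-- The class module `Cl(X_Σ) = Div(X_Σ) / Div_c(X_Σ)`. -/
abbrev Cl := A.Weil ⧸ A.charDivs

/-- The Picard module `Pic(X_Σ) = CDiv(X_Σ) / Div_c(X_Σ)`. -/
abbrev Pic := A.CDiv σ ⧸ A.charDivs.comap (A.CDiv σ).subtype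

/-- The natural embedding `Pic(X_Σ) → Cl(X_Σ)`. -/
def picToCl : A.Pic σ →ₗ[ℤ[X]] A.Cl :=
  Submodule.mapQ _ _ (A.CDiv σ).subtype le_rfl

/-- `X_Σ` is smooth: `Cl(X_Σ) = Pic(X_Σ)`, that is, the embedding of `Pic` in `Cl` is onto. -/
def VarIsSmooth : Prop := Function.Bijective (A.picToCl σ)

end Variety

end Fan

end ToricP

end

/-! Characteristic divisors are Cartier, so `X_Σ` is smooth exactly when every Weil divisor is
Cartier (`varIsSmooth_iff`). Both directions compare a divisor `∑ a_L D_L` with a character on one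
chart at a time.

If `Σ` is smooth, the images of the charts serve as the open cover. A prime divisor that meets the
`i`-th image comes from a facet of `S_i` (`exists_facetRel`), so only the coefficients at facets of
`S_i` matter there. The normals of these facets are a basis of the dual of a free module of finite
rank, so by reflexivity some `u` takes the prescribed values on them
(`IsSmooth.exists_normalOn_eq`).

Conversely, if `S_i` is pointed, killing all `χ^u` with `u ≠ 0` defines a point, the origin, which
lies on `D(F)` for every facet `F` of `S_i`. Distinct facets of `S_i` are inequivalent
(`facet_eq_of_mk_eq`), so arbitrary values `a_F` are the coefficients of a divisor, and the Cartier
condition at the origin gives one `u` with `φ_F(u) = a_F` for all `F`. Hence there are vectors dual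
to the normals, which are therefore independent. They span because they separate the points of the
lattice (`eq_zero_of_forall_stdNormal`).

Separation is convex geometry over the ordered ring `ℤ[x]`, done without division. Gordan's theorem
(`exists_functional_pos_of_no_relation`) gives a functional positive on the nonzero generators; it
is perturbed so as not to vanish at the given vector and then pivoted to a facet
(`exists_facet_functional`). Standard normal vectors exist by unique factorization
(`exists_generator_annihilator`). -/

namespace ToricP

/-! ### Linear functionals and convexity over domains and ordered rings -/

section OrderedRing

variable {R : Type*} [CommRing R] {V : Type*} [AddCommGroup V] [Module R V]

/-- A linear functional that vanishes on `Z` but not at a given vector `u` which is not torsion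
modulo `Z`. -/
theorem exists_functional_ne_zero [IsDomain R] [Module.Finite R V] (Z : Submodule R V) (u : V)
    (hu : ∀ c : R, c • u ∈ Z → c = 0) :
    ∃ φ : V →ₗ[R] R, (∀ z ∈ Z, φ z = 0) ∧ φ u ≠ 0 := by
  classical
  let K := FractionRing R
  let f : (V ⧸ Z) →ₗ[R] LocalizedModule (nonZeroDivisors R) (V ⧸ Z) :=
    LocalizedModule.mkLinearMap (nonZeroDivisors R) (V ⧸ Z)
  have hfu : f (Z.mkQ u) ≠ 0 := by
    intro h
    rw [IsLocalizedModule.eq_zero_iff (nonZeroDivisors R) f] at h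
    obtain ⟨c, hc⟩ := h
    have : (c : R) • u ∈ Z := by
      rw [← Submodule.Quotient.mk_eq_zero, Submodule.Quotient.mk_smul]
      exact hc
    exact nonZeroDivisors.coe_ne_zero c (hu _ this)
  obtain ⟨ψ, hψ⟩ : ∃ ψ : LocalizedModule (nonZeroDivisors R) (V ⧸ Z) →ₗ[K] K,
      ψ (f (Z.mkQ u)) ≠ 0 := by
    by_contra! h
    exact hfu ((Module.forall_dual_apply_eq_zero_iff K _).1 h)
  let g : V →ₗ[R] K := (ψ.restrictScalars R) ∘ₗ f ∘ₗ Z.mkQ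
  obtain ⟨s, hs⟩ := (Module.finite_def (R := R) (M := V)).1 inferInstance
  -- A common denominator of the values of `g` on a finite generating set makes `b • g` take values
  -- in `R`.
  obtain ⟨b, hb⟩ := IsLocalization.exist_integer_multiples_of_finset (nonZeroDivisors R)
    (s.image g)
  have hr : ∀ v : V, ((b : R) • g) v ∈ LinearMap.range (Algebra.linearMap R K) := by
    intro v
    have hv : v ∈ Submodule.span R (s : Set V) := hs ▸ Submodule.mem_top
    have : Submodule.span R (s : Set V) ≤
        (LinearMap.range (Algebra.linearMap R K)).comap ((b : R) • g) := by
      rw [Submodule.span_le]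
      intro w hw
      obtain ⟨a, ha⟩ := hb (g w) (Finset.mem_image_of_mem _ hw)
      exact ⟨a, ha⟩
    exact this hv
  let e := LinearEquiv.ofInjective (Algebra.linearMap R K) (IsFractionRing.injective R K)
  let φ : V →ₗ[R] R := e.symm.toLinearMap ∘ₗ ((b : R) • g).codRestrict _ hr
  have hφ : ∀ v, algebraMap R K (φ v) = (b : R) • g v := fun v => by
    have := e.apply_symm_apply (((b : R) • g).codRestrict _ hr v)
    exact congrArg Subtype.val this
  refine ⟨φ, fun z hz => ?_, fun h => ?_⟩
  · apply IsFractionRing.injective R K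
    rw [hφ, map_zero]
    have : Z.mkQ z = 0 := by simpa using hz
    simp [g, this]
  · have h1 := hφ u
    rw [h, map_zero, eq_comm, smul_eq_zero] at h1
    rcases h1 with h1 | h1
    · exact nonZeroDivisors.coe_ne_zero b h1
    · exact hψ h1

/-- If `W` has corank one and `u` is not torsion modulo `W`, then everything is torsion modulo
`W + R u`. -/
theorem exists_smul_mem_sup_span [IsDomain R] [Module.Finite R V] {W : Submodule R V}
    (hW : Module.finrank R W + 1 = Module.finrank R V) {u : V}
    (hu : ∀ c : R, c • u ∈ W → c = 0) (v : V) :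
    ∃ c d : R, c ≠ 0 ∧ c • v + d • u ∈ W := by
  have h1 : Module.finrank R (V ⧸ W) = 1 := by
    have := W.finrank_quotient_add_finrank
    omega
  have h2 : ¬ LinearIndependent R ![W.mkQ v, W.mkQ u] := by
    intro h
    have := h.fintype_card_le_finrank
    simp [h1] at this
  rw [LinearIndependent.pair_iff] at h2
  push Not at h2
  obtain ⟨c, d, h, hcd⟩ := h2
  have hm : c • v + d • u ∈ W := by
    rw [← Submodule.Quotient.mk_eq_zero]
    exact h
  refine ⟨c, d, fun hc => hcd hc (hu d ?_), hm⟩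
  simpa [hc] using hm

theorem finrank_lt_of_not_torsion [IsDomain R] [Module.Finite R V] {W : Submodule R V} {u : V}
    (hu : ∀ c : R, c • u ∈ W → c = 0) : Module.finrank R W < Module.finrank R V := by
  have h1 : Module.finrank R (V ⧸ W) ≠ 0 := by
    rw [Ne, Module.finrank_eq_zero_iff]
    intro h
    obtain ⟨c, hc, h0⟩ := h (W.mkQ u)
    rw [← map_smul, Submodule.mkQ_apply, Submodule.Quotient.mk_eq_zero] at h0
    exact hc (hu c h0)
  have := W.finrank_quotient_add_finrank
  omega

theorem finrank_lt_finrank_of_not_torsion [IsDomain R] [IsNoetherianRing R] [Module.Finite R V]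
    {W W' : Submodule R V} (h : W ≤ W') {u : V} (hu' : u ∈ W') (hu : ∀ c : R, c • u ∈ W → c = 0) :
    Module.finrank R W < Module.finrank R W' := by
  rw [← (Submodule.submoduleOfEquivOfLe h).finrank_eq]
  exact finrank_lt_of_not_torsion (u := ⟨u, hu'⟩) fun c hc => hu c hc

/-- A submodule of corank at least one does not make the whole module torsion. -/
theorem exists_not_torsion_of_finrank_lt [IsDomain R] [Module.Finite R V] {W : Submodule R V}
    (hW : Module.finrank R W < Module.finrank R V) : ∃ u : V, ∀ c : R, c • u ∈ W → c = 0 := by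
  by_contra! h
  have h1 : Module.finrank R (V ⧸ W) = 0 := by
    rw [Module.finrank_eq_zero_iff]
    intro x
    obtain ⟨v, rfl⟩ := W.mkQ_surjective x
    obtain ⟨c, hc, hc0⟩ := h v
    refine ⟨c, hc0, ?_⟩
    rw [← map_smul, Submodule.mkQ_apply, Submodule.Quotient.mk_eq_zero]
    exact hc
  have := W.finrank_quotient_add_finrank
  omega

/-- The functionals that vanish on a submodule of corank one are the multiples of one of them. -/
theorem exists_generator_annihilator [IsDomain R] [UniqueFactorizationMonoid R] [Module.Finite R V]
    [Module.Free R V] {W : Submodule R V} (hW : Module.finrank R W + 1 = Module.finrank R V) :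
    ∃ ν : V →ₗ[R] R, ν ≠ 0 ∧ (∀ w ∈ W, ν w = 0) ∧
      (∀ ψ : V →ₗ[R] R, (∀ w ∈ W, ψ w = 0) → ∃ c : R, ψ = c • ν) ∧
      ∀ v, ν v = 0 → ∃ c : R, c ≠ 0 ∧ c • v ∈ W := by
  classical
  obtain ⟨u, hu⟩ := exists_not_torsion_of_finrank_lt (W := W) (by omega)
  obtain ⟨φ, hφ, hφu⟩ := exists_functional_ne_zero W u hu
  let b := Module.Free.chooseBasis R V
  let _ : NormalizedGCDMonoid R :=
    Classical.choice (inferInstanceAs (Nonempty (NormalizedGCDMonoid R)))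
  have hne : (Finset.univ : Finset (Module.Free.ChooseBasisIndex R V)).Nonempty := by
    by_contra h
    rw [Finset.not_nonempty_iff_eq_empty, Finset.univ_eq_empty_iff] at h
    have : φ = 0 := b.ext fun i => h.elim i
    exact hφu (by simp [this])
  -- Dividing `φ` by the gcd of its coordinates gives a primitive functional `ν`.
  obtain ⟨g, hg, hg1⟩ := Finset.extract_gcd (fun i => φ (b i)) hne
  set d := Finset.univ.gcd fun i => φ (b i) with hd
  let ν : V →ₗ[R] R := b.constr R g
  have hνb : ∀ i, ν (b i) = g i := fun i => b.constr_basis R g i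
  have hφν : φ = d • ν := b.ext fun i => by
    rw [LinearMap.smul_apply, hνb, smul_eq_mul]
    exact hg i (Finset.mem_univ i)
  have hd0 : d ≠ 0 := fun h => hφu (by simp [hφν, h])
  have hνu : ν u ≠ 0 := fun h => hφu (by simp [hφν, h])
  have hνW : ∀ w ∈ W, ν w = 0 := fun w hw => by
    have := hφ w hw
    rw [hφν, LinearMap.smul_apply, smul_eq_mul] at this
    exact (mul_eq_zero.1 this).resolve_left hd0
  have hν0 : ν ≠ 0 := fun h => hνu (by simp [h])
  refine ⟨ν, hν0, hνW, fun ψ hψ => ?_, fun v hv => ?_⟩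
  -- Both functionals vanish on `W`, and everything is torsion modulo `W + R u`, so they are
  -- determined by their values at `u`.
  · have key : ν u • ψ = ψ u • ν := by
      ext v
      obtain ⟨c, e, hc, hce⟩ := exists_smul_mem_sup_span hW hu v
      have h1 := hψ _ hce
      have h2 := hνW _ hce
      simp only [map_add, map_smul, smul_eq_mul, LinearMap.smul_apply] at h1 h2 ⊢
      apply mul_left_cancel₀ hc
      linear_combination ν u * h1 - ψ u * h2
    -- Primitivity enters here: `ν u` divides every `ψ u * g i`, hence their gcd, which is `ψ u` up
    -- to a unit.
    have hdvd : ν u ∣ ψ u := by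
      have h1 : ν u ∣ Finset.univ.gcd fun i => ψ u * g i := by
        refine Finset.dvd_gcd fun i _ => ⟨ψ (b i), ?_⟩
        have := LinearMap.congr_fun key (b i)
        simp only [LinearMap.smul_apply, smul_eq_mul, hνb] at this
        exact this.symm
      have h2 := h1.trans (Finset.gcd_mul_left' Finset.univ g (ψ u)).dvd
      rwa [hg1, mul_one] at h2
    obtain ⟨c, hc⟩ := hdvd
    refine ⟨c, ?_⟩
    apply smul_right_injective _ hνu
    change ν u • ψ = ν u • c • ν
    rw [key, hc, mul_smul]
  · by_contra! h
    have h' : ∀ c : R, c • v ∈ W → c = 0 := fun c hc => by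
      by_contra h0
      exact h c h0 hc
    apply hν0
    ext x
    obtain ⟨c, e, hc, hce⟩ := exists_smul_mem_sup_span hW h' x
    have := hνW _ hce
    simp only [map_add, map_smul, smul_eq_mul, hv, mul_zero, add_zero] at this
    exact (mul_eq_zero.1 this).resolve_left hc

variable [LinearOrder R] [IsStrictOrderedRing R]

theorem exists_functional_pos [Module.Finite R V] (Z : Submodule R V) (u : V)
    (hu : ∀ c : R, c • u ∈ Z → c = 0) :
    ∃ φ : V →ₗ[R] R, (∀ z ∈ Z, φ z = 0) ∧ 0 < φ u := by
  obtain ⟨φ, h, h0⟩ := exists_functional_ne_zero Z u hu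
  rcases lt_or_gt_of_ne h0 with h1 | h1
  · exact ⟨-φ, fun z hz => by simp [h z hz], by simpa using h1⟩
  · exact ⟨φ, h, h1⟩

/-- Perturbation of a functional that is positive on a finite set. -/
theorem exists_perturbation_pos (U : Finset V) (ψ φ : V →ₗ[R] R) (hψ : ∀ u ∈ U, 0 < ψ u) :
    ∃ a b : R, 0 < b ∧ ∀ u ∈ U, 0 < (a • ψ + b • φ) u := by
  classical
  induction U using Finset.induction_on with
  | empty => exact ⟨0, 1, one_pos, by simp⟩
  | insert u U _ ih =>
    obtain ⟨a, b, hb, h⟩ := ih fun w hw => hψ w (Finset.mem_insert_of_mem hw)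
    have hu := hψ u (Finset.mem_insert_self _ _)
    by_cases h0 : 0 < (a • ψ + b • φ) u
    · exact ⟨a, b, hb, fun w hw => (Finset.mem_insert.1 hw).elim (fun e => e ▸ h0) (h w)⟩
    -- Scale the old combination by `ψ u` and add enough of `ψ` that the value at `u` becomes
    -- exactly `ψ u`. The added multiple is positive because the old value at `u` is at most `0`.
    · refine ⟨ψ u * a + (1 - (a • ψ + b • φ) u), ψ u * b, mul_pos hu hb, fun w hw => ?_⟩
      have e : ∀ w, ((ψ u * a + (1 - (a • ψ + b • φ) u)) • ψ + (ψ u * b) • φ) w =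
          ψ u * (a • ψ + b • φ) w + (1 - (a • ψ + b • φ) u) * ψ w := fun w => by
        simp only [LinearMap.add_apply, LinearMap.smul_apply, smul_eq_mul]
        ring
      rw [e]
      rcases Finset.mem_insert.1 hw with rfl | hw'
      · calc 0 < ψ w := hu
          _ = _ := by ring
      · refine add_pos (mul_pos hu (h w hw')) (mul_pos ?_ (hψ w hw))
        linarith

/-- Gordan's theorem relative to a submodule `Z`. -/
theorem exists_functional_pos_of_no_relation [Module.Finite R V] (U : Finset V) :
    ∀ Z : Submodule R V,
      (∀ c : V → R, (∀ u ∈ U, 0 ≤ c u) → ∑ u ∈ U, c u • u ∈ Z → ∀ u ∈ U, c u = 0) →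
      ∃ φ : V →ₗ[R] R, (∀ z ∈ Z, φ z = 0) ∧ ∀ u ∈ U, 0 < φ u := by
  classical
  induction U using Finset.induction_on with
  | empty => exact fun Z _ => ⟨0, by simp, by simp⟩
  | insert u U hU ih =>
    intro Z hZ
    have hcomb : ∀ (c : V → R) (a : R), (∀ w ∈ U, 0 ≤ c w) → 0 ≤ a →
        ∑ w ∈ U, c w • w + a • u ∈ Z → a = 0 ∧ ∀ w ∈ U, c w = 0 := by
      intro c a hc ha hm
      have hne : ∀ w ∈ U, w ≠ u := fun w hw e => hU (e ▸ hw)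
      have := hZ (Function.update c u a) (fun w hw => by
        rcases Finset.mem_insert.1 hw with rfl | hw
        · simpa using ha
        · simpa [hne w hw] using hc w hw) (by
        rw [Finset.sum_insert hU, add_comm]
        convert hm using 2
        · exact Finset.sum_congr rfl fun w hw => by simp [hne w hw]
        · simp)
      refine ⟨by simpa using this u (Finset.mem_insert_self _ _), fun w hw => ?_⟩
      simpa [hne w hw] using this w (Finset.mem_insert_of_mem hw)
    obtain ⟨φ, hφZ, hφ⟩ := ih Z fun c hc hm => (hcomb c 0 hc le_rfl (by simpa using hm)).2
    have hu : ∀ c : R, c • u ∈ Z → c = 0 := by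
      intro c hc
      rcases le_total 0 c with h | h
      · exact (hcomb 0 c (by simp) h (by simpa using hc)).1
      · have := (hcomb 0 (-c) (by simp) (by simpa using h) (by simpa using hc)).1
        simpa using this
    -- Without relations modulo `Z + R u`, a functional that kills `u` and is positive on `U` can be
    -- tilted towards `u`. Otherwise a relation expresses a positive multiple of `u` through `U`
    -- modulo `Z`, and the functional `φ` found for `U` is already positive at `u`.
    by_cases hrel : ∀ c : V → R, (∀ w ∈ U, 0 ≤ c w) →
        ∑ w ∈ U, c w • w ∈ Z ⊔ Submodule.span R {u} → ∀ w ∈ U, c w = 0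
    · obtain ⟨ψ, hψZ, hψ⟩ := ih _ hrel
      obtain ⟨φ₀, h₀Z, h₀⟩ := exists_functional_pos Z u hu
      obtain ⟨a, b, hb, hab⟩ := exists_perturbation_pos U ψ φ₀ hψ
      refine ⟨a • ψ + b • φ₀, fun z hz => ?_, fun w hw => ?_⟩
      · simp [h₀Z z hz, hψZ z (Submodule.mem_sup_left hz)]
      · rcases Finset.mem_insert.1 hw with rfl | hw
        · have : ψ w = 0 :=
            hψZ w (Submodule.mem_sup_right (Submodule.mem_span_singleton_self w))
          simpa [this] using mul_pos hb h₀
        · exact hab w hw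
    · push Not at hrel
      obtain ⟨c, hc, hm, w, hw, hcw⟩ := hrel
      obtain ⟨z, hz, y, hy, hzy⟩ := Submodule.mem_sup.1 hm
      obtain ⟨a, rfl⟩ := Submodule.mem_span_singleton.1 hy
      have ha : 0 < a := by
        by_contra! h
        refine hcw ((hcomb c (-a) hc (by simpa using h) ?_).2 w hw)
        rw [← hzy]
        simpa using hz
      have hsum : 0 < ∑ w ∈ U, c w * φ w :=
        Finset.sum_pos' (fun w hw => mul_nonneg (hc w hw) (hφ w hw).le)
          ⟨w, hw, mul_pos (lt_of_le_of_ne (hc w hw) (Ne.symm hcw)) (hφ w hw)⟩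
      have hval : a * φ u = ∑ w ∈ U, c w * φ w := by
        have := congrArg φ hzy
        simpa [hφZ z hz] using this
      refine ⟨φ, hφZ, fun w hw => ?_⟩
      rcases Finset.mem_insert.1 hw with rfl | hw
      · exact pos_of_mul_pos_right (hval ▸ hsum) ha.le
      · exact hφ w hw

/-- The minimum of `p / q`, cross-multiplied because `R` need not have inverses. This is the ratio
test for the pivot in `exists_facet_functional`. -/
theorem exists_min_ratio {α : Type*} {T : Finset α} (hT : T.Nonempty) (p q : α → R)
    (hq : ∀ t ∈ T, 0 < q t) : ∃ s ∈ T, ∀ t ∈ T, p s * q t ≤ p t * q s := by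
  classical
  induction hT using Finset.Nonempty.cons_induction with
  | singleton a => exact ⟨a, by simp, by simp⟩
  | cons a T ha hT ih =>
    obtain ⟨s, hs, h⟩ := ih fun t ht => hq t (Finset.mem_cons_of_mem ht)
    have hqa := hq a (Finset.mem_cons_self _ _)
    have hqs := hq s (Finset.mem_cons_of_mem hs)
    rcases le_total (p s * q a) (p a * q s) with h1 | h1
    · refine ⟨s, Finset.mem_cons_of_mem hs, fun t ht => ?_⟩
      rcases Finset.mem_cons.1 ht with rfl | ht
      exacts [h1, h t ht]
    · refine ⟨a, Finset.mem_cons_self _ _, fun t ht => ?_⟩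
      rcases Finset.mem_cons.1 ht with rfl | ht
      · exact le_rfl
      · have hqt := hq t (Finset.mem_cons_of_mem ht)
        refine le_of_mul_le_mul_left ?_ hqs
        calc q s * (p a * q t) = (p a * q s) * q t := by ring
          _ ≤ (p s * q a) * q t := mul_le_mul_of_nonneg_right h1 hqt.le
          _ = (p s * q t) * q a := by ring
          _ ≤ (p t * q s) * q a := mul_le_mul_of_nonneg_right (h t ht) hqa.le
          _ = q s * (p t * q a) := by ring

/-- A functional that is nonnegative on a finite spanning set `U` and negative at `v` can be chosen
so that its zeros in `U` span a submodule of corank one. -/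
theorem exists_facet_functional [IsNoetherianRing R] [Module.Finite R V] (U : Finset V)
    (hU : Submodule.span R (U : Set V) = ⊤) (v : V) (φ : V →ₗ[R] R) (hφ : ∀ u ∈ U, 0 ≤ φ u)
    (hv : φ v < 0) :
    ∃ ψ : V →ₗ[R] R, (∀ u ∈ U, 0 ≤ ψ u) ∧ ψ v < 0 ∧
      Module.finrank R (Submodule.span R {u | u ∈ U ∧ ψ u = 0}) + 1 = Module.finrank R V := by
  classical
  -- Induction on a bound `d` for how far the zeros of `φ` in `U` are from spanning corank one; each
  -- pivot lowers it.
  obtain ⟨d, hd⟩ : ∃ d, Module.finrank R V ≤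
      Module.finrank R (Submodule.span R {u | u ∈ U ∧ φ u = 0}) + 1 + d :=
    ⟨Module.finrank R V, by omega⟩
  induction d generalizing φ with
  | zero =>
    refine ⟨φ, hφ, hv, le_antisymm ?_ (by simpa using hd)⟩
    refine finrank_lt_of_not_torsion (u := v) fun c hc => ?_
    have hle : Submodule.span R {u | u ∈ U ∧ φ u = 0} ≤ LinearMap.ker φ :=
      Submodule.span_le.2 fun u hu => hu.2
    have := hle hc
    rw [LinearMap.mem_ker, map_smul, smul_eq_mul] at this
    exact (mul_eq_zero.1 this).resolve_right hv.ne
  | succ d ih =>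
    set W := Submodule.span R {u | u ∈ U ∧ φ u = 0} with hW
    by_cases hlt : Module.finrank R V ≤ Module.finrank R W + 1 + d
    · exact ih φ hφ hv hlt
    -- Here `W` has corank at least two, so there is room for a nonzero functional that kills both
    -- `W` and `v`.
    have hW2 : Module.finrank R (W ⊔ Submodule.span R {v} : Submodule R V) <
        Module.finrank R V := by
      have h1 := Submodule.rank_add_le_rank_add_rank W (Submodule.span R {v})
      have h2 : Module.rank R (Submodule.span R {v}) ≤ 1 :=
        rank_le_one ⟨v, Submodule.mem_span_singleton_self v⟩ fun w => by
          obtain ⟨c, hc⟩ := Submodule.mem_span_singleton.1 w.2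
          exact ⟨c, Subtype.ext hc⟩
      have h3 := h1.trans (add_le_add_right h2 _)
      rw [← Module.finrank_eq_rank, ← Module.finrank_eq_rank] at h3
      have h4 : Module.finrank R (W ⊔ Submodule.span R {v} : Submodule R V) ≤
          Module.finrank R W + 1 := by exact_mod_cast h3
      omega
    obtain ⟨w, hw⟩ := exists_not_torsion_of_finrank_lt hW2
    obtain ⟨ψ, hψ, u₀, hu₀, hψu₀⟩ : ∃ ψ : V →ₗ[R] R,
        (∀ z ∈ W ⊔ Submodule.span R {v}, ψ z = 0) ∧ ∃ u ∈ U, 0 < -ψ u := by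
      obtain ⟨ψ, hψ, hψw⟩ := exists_functional_ne_zero _ w hw
      obtain ⟨u, hu, hψu⟩ : ∃ u ∈ U, ψ u ≠ 0 := by
        by_contra! h
        have : ψ = 0 := LinearMap.ext_on hU fun u hu => h u hu
        exact hψw (by simp [this])
      rcases lt_or_gt_of_ne hψu with h | h
      · exact ⟨ψ, hψ, u, hu, by simpa using h⟩
      · exact ⟨-ψ, fun z hz => by simp [hψ z hz], u, hu, by simpa using h⟩
    obtain ⟨s, hs, hmin⟩ := exists_min_ratio (T := U.filter fun u => 0 < -ψ u)
      ⟨u₀, Finset.mem_filter.2 ⟨hu₀, hψu₀⟩⟩ φ (fun u => -ψ u) fun t ht =>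
        (Finset.mem_filter.1 ht).2
    obtain ⟨hsU, hψs⟩ := Finset.mem_filter.1 hs
    have hψv : ψ v = 0 :=
      hψ v (Submodule.mem_sup_right (Submodule.mem_span_singleton_self v))
    have hval : ∀ u, ((-ψ s) • φ + φ s • ψ) u = -ψ s * φ u + φ s * ψ u := fun u => by simp
    -- Tilt `φ` along `ψ` until the first generator `s` reaches zero. Minimality of the ratio keeps
    -- `U` nonnegative, the sign at `v` is unchanged since `ψ v = 0`, and `s` is a new zero,
    -- independent of `W` since `ψ s ≠ 0`.
    refine ih ((-ψ s) • φ + φ s • ψ) (fun u hu => ?_) ?_ ?_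
    · rw [hval]
      by_cases h : 0 < -ψ u
      · have := hmin u (Finset.mem_filter.2 ⟨hu, h⟩)
        linarith
      · exact add_nonneg (mul_nonneg hψs.le (hφ u hu))
          (mul_nonneg (hφ s hsU) (by linarith))
    · rw [hval, hψv, mul_zero, add_zero]
      exact mul_neg_of_pos_of_neg hψs hv
    · have : Module.finrank R W < Module.finrank R
          (Submodule.span R {u | u ∈ U ∧ ((-ψ s) • φ + φ s • ψ) u = 0}) := by
        refine finrank_lt_finrank_of_not_torsion (u := s) ?_ (Submodule.subset_span ⟨hsU, ?_⟩) ?_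
        · refine Submodule.span_mono fun u hu => ⟨hu.1, ?_⟩
          rw [hval, hu.2, hψ u (Submodule.mem_sup_left (Submodule.subset_span hu))]
          simp
        · rw [hval]
          ring
        · intro c hc
          have := hψ _ (Submodule.mem_sup_left hc)
          rw [map_smul, smul_eq_mul] at this
          refine (mul_eq_zero.1 this).resolve_right fun h => ?_
          simp [h] at hψs
      omega

end OrderedRing

/-! ### The ordered ring `ℤ[x]` -/

section PolynomialOrder

theorem IsNonneg.eq_zero {f : ℤ[X]} (h : IsNonneg f) (h' : IsNonneg (-f)) : f = 0 := by
  unfold IsNonneg at *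
  rw [leadingCoeff_neg] at h'
  rw [← leadingCoeff_eq_zero]
  omega

open Classical in
/-- The total order on `ℤ[x]` in which `x` is infinitely large. -/
noncomputable instance : LinearOrder ℤ[X] where
  le f g := IsNonneg (g - f)
  le_refl f := by simp [IsNonneg]
  le_trans f g h h1 h2 := by simpa using IsNonneg.add h1 h2
  le_antisymm f g h1 h2 :=
    (sub_eq_zero.1 (IsNonneg.eq_zero h1 (by simpa using h2))).symm
  le_total f g := by
    unfold IsNonneg
    rw [← neg_sub f g, leadingCoeff_neg]
    omega
  toDecidableLE := inferInstance

theorem isNonneg_iff {f : ℤ[X]} : IsNonneg f ↔ 0 ≤ f := by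
  change _ ↔ IsNonneg (f - 0)
  rw [sub_zero]

instance : IsStrictOrderedRing ℤ[X] :=
  have : IsOrderedAddMonoid ℤ[X] :=
    { add_le_add_left := fun a b h c => by
        change IsNonneg _
        rw [add_sub_add_right_eq_sub]
        exact h }
  have : ZeroLEOneClass ℤ[X] := ⟨isNonneg_iff.1 (by simp [IsNonneg])⟩
  IsStrictOrderedRing.of_mul_pos fun a b ha hb => by
    refine lt_of_le_of_ne (isNonneg_iff.1 ?_) (mul_ne_zero ha.ne' hb.ne').symm
    unfold IsNonneg
    rw [leadingCoeff_mul]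
    exact mul_nonneg (isNonneg_iff.2 ha.le) (isNonneg_iff.2 hb.le)

theorem eq_one_of_pos_of_isUnit {c : ℤ[X]} (hc : 0 < c) (h : IsUnit c) : c = 1 := by
  obtain ⟨r, hr, rfl⟩ := Polynomial.isUnit_iff.1 h
  rcases Int.isUnit_iff.1 hr with rfl | rfl
  · simp
  · simp only [map_neg, map_one, Left.neg_pos_iff] at hc
    exact absurd hc (not_lt.2 zero_le_one)

end PolynomialOrder

/-! ### Faces, standard normal vectors and separation of points -/

section Normals

variable {n : ℕ} {S F T H : Semi n}

theorem smul_mem_of_nonneg (S : Semi n) {c : ℤ[X]} (hc : 0 ≤ c) {u : Amb n} (hu : u ∈ S) :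
    c • u ∈ S :=
  S.smul_mem ⟨c, isNonneg_iff.2 hc⟩ hu

theorem IsFace.mem_of_smul_mem (hF : IsFace S F) {c : ℤ[X]} (hc : 0 < c) {u : Amb n} (hu : u ∈ S)
    (h : c • u ∈ F) : u ∈ F :=
  hF.smul_mem ⟨c, isNonneg_iff.2 hc.le⟩ (fun h0 => hc.ne' (congrArg Subtype.val h0)) u hu h

theorem le_md (S : Semi n) {u : Amb n} (hu : u ∈ S) : u ∈ md S := Submodule.subset_span hu

theorem md_mono (h : F ≤ S) : md F ≤ md S := Submodule.span_mono h

/-- The order on `ℤ[x]` is total, so a scalar or its negative lies in `P[x]`; differences are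
therefore closed under all scalars. -/
theorem mem_md_iff {x : Amb n} : x ∈ md S ↔ ∃ a ∈ S, ∃ b ∈ S, x = a - b := by
  constructor
  · intro hx
    induction hx using Submodule.span_induction with
    | mem x h => exact ⟨x, h, 0, S.zero_mem, by simp⟩
    | zero => exact ⟨0, S.zero_mem, 0, S.zero_mem, by simp⟩
    | add x y _ _ ihx ihy =>
      obtain ⟨a, ha, b, hb, rfl⟩ := ihx
      obtain ⟨a', ha', b', hb', rfl⟩ := ihy
      exact ⟨a + a', S.add_mem ha ha', b + b', S.add_mem hb hb', by abel⟩
    | smul c x _ ih =>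
      obtain ⟨a, ha, b, hb, rfl⟩ := ih
      rcases le_total 0 c with h | h
      · exact ⟨c • a, smul_mem_of_nonneg S h ha, c • b, smul_mem_of_nonneg S h hb, smul_sub _ _ _⟩
      · have h' : 0 ≤ -c := by simpa using h
        exact ⟨-c • b, smul_mem_of_nonneg S h' hb, -c • a, smul_mem_of_nonneg S h' ha, by module⟩
  · rintro ⟨a, ha, b, hb, rfl⟩
    exact sub_mem (le_md S ha) (le_md S hb)

theorem IsFace.mem_of_mem_md (hF : IsFace S F) {u : Amb n} (hu : u ∈ S) (h : u ∈ md F) : u ∈ F := by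
  obtain ⟨a, ha, b, hb, rfl⟩ := mem_md_iff.1 h
  exact (hF.add_mem _ hu b (hF.le hb) (by simpa using ha)).1

/-- `φ` is a nonnegative functional on the lattice `L` that cuts out `F` in `S` and generates the
annihilator of `F`. -/
structure IsNormalOn (S F : Semi n) {L : Submodule ℤ[X] (Amb n)} (φ : L →ₗ[ℤ[X]] ℤ[X]) : Prop where
  nonneg : ∀ u : L, (u : Amb n) ∈ S → 0 ≤ φ u
  mem_iff : ∀ u : L, (u : Amb n) ∈ F ↔ φ u = 0 ∧ (u : Amb n) ∈ S
  gen : ∀ ψ : L →ₗ[ℤ[X]] ℤ[X], (∀ w : L, (w : Amb n) ∈ F → ψ w = 0) → ∃ c : ℤ[X], ψ = c • φ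

theorem map_eq_zero_of_mem_md {L : Submodule ℤ[X] (Amb n)} (hF : md F ≤ L) {ψ : L →ₗ[ℤ[X]] ℤ[X]}
    (h : ∀ w : L, (w : Amb n) ∈ F → ψ w = 0) (w : L) (hw : (w : Amb n) ∈ md F) : ψ w = 0 := by
  obtain ⟨a, ha, b, hb, hab⟩ := mem_md_iff.1 hw
  have : w = ⟨a, hF (le_md F ha)⟩ - ⟨b, hF (le_md F hb)⟩ := Subtype.ext hab
  rw [this, map_sub, h _ ha, h _ hb, sub_zero]

theorem exists_mem_ne_zero {φ : md S →ₗ[ℤ[X]] ℤ[X]} (h : φ ≠ 0) :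
    ∃ u : md S, (u : Amb n) ∈ S ∧ φ u ≠ 0 := by
  by_contra! h0
  exact h (LinearMap.ext fun w => map_eq_zero_of_mem_md le_rfl h0 w w.2)

theorem finrank_submoduleOf_md (h : F ≤ S) :
    Module.finrank ℤ[X] ((md F).submoduleOf (md S)) = rank F :=
  (Submodule.submoduleOfEquivOfLe (md_mono h)).finrank_eq

/-- The generator of the annihilator of `F` cuts out `F` by the face axioms, and it has constant
sign on `S`, so it or its negative is the normal. -/
theorem exists_isNormalOn [Module.Free ℤ[X] (md S)] (hF : IsFace S F) (hr : rank F + 1 = rank S) :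
    ∃ φ : md S →ₗ[ℤ[X]] ℤ[X], IsNormalOn S F φ := by
  obtain ⟨ν, -, hW, hgen, htor⟩ := exists_generator_annihilator
    (W := (md F).submoduleOf (md S)) (by rw [finrank_submoduleOf_md hF.le]; exact hr)
  have hker : ∀ u : md S, (u : Amb n) ∈ S → ν u = 0 → (u : Amb n) ∈ F := by
    intro u hu h0
    obtain ⟨c, hc, hcu⟩ := htor u h0
    have hcu : c • (u : Amb n) ∈ md F := hcu
    rcases lt_or_gt_of_ne hc with h | h
    · have h' : 0 < -c := by simpa using h
      refine hF.mem_of_smul_mem h' hu (hF.mem_of_mem_md (smul_mem_of_nonneg S h'.le hu) ?_)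
      rw [neg_smul]
      exact neg_mem hcu
    · exact hF.mem_of_smul_mem h hu (hF.mem_of_mem_md (smul_mem_of_nonneg S h.le hu) hcu)
  have hF0 : ∀ w : md S, (w : Amb n) ∈ F → ν w = 0 := fun w hw => hW w (le_md F hw)
  have hgen' : ∀ ψ : md S →ₗ[ℤ[X]] ℤ[X], (∀ w : md S, (w : Amb n) ∈ F → ψ w = 0) →
      ∃ c : ℤ[X], ψ = c • ν :=
    fun ψ hψ => hgen ψ fun w hw => map_eq_zero_of_mem_md (md_mono hF.le) hψ w hw
  by_cases hpos : ∀ u : md S, (u : Amb n) ∈ S → 0 ≤ ν u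
  · exact ⟨ν, hpos, fun u => ⟨fun h => ⟨hF0 u h, hF.le h⟩, fun h => hker u h.2 h.1⟩, hgen'⟩
  · push Not at hpos
    obtain ⟨b, hb, hνb⟩ := hpos
    refine ⟨-ν, fun u hu => ?_, fun u => ?_, fun ψ hψ => ?_⟩
    -- If `ν` were positive at `u` and negative at `b`, a positive combination of the two would lie
    -- in its kernel, hence in `F`; the face axioms would put `u` in `F`, where `ν` vanishes.
    · by_contra! h
      have hνu : 0 < ν u := by simpa using h
      have hνb' : 0 < -ν b := by simpa using hνb
      have h1 : (-ν b) • (u : Amb n) ∈ S := smul_mem_of_nonneg S hνb'.le hu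
      have h2 : ν u • (b : Amb n) ∈ S := smul_mem_of_nonneg S hνu.le hb
      have h3 := hker ((-ν b) • u + ν u • b) (S.add_mem h1 h2) (by
        simp only [map_add, map_smul, smul_eq_mul]
        ring)
      have h4 := hF.mem_of_smul_mem hνb' hu (hF.add_mem _ h1 _ h2 h3).1
      exact hνu.ne' (hF0 u h4)
    · rw [LinearMap.neg_apply, neg_eq_zero]
      exact ⟨fun h => ⟨hF0 u h, hF.le h⟩, fun h => hker u h.2 h.1⟩
    · obtain ⟨c, rfl⟩ := hgen' ψ hψ
      exact ⟨-c, by simp⟩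

theorem IsNormalOn.ne_zero {φ : md S →ₗ[ℤ[X]] ℤ[X]} (h : IsNormalOn S F φ) (hF : F ≤ S)
    (hr : rank F + 1 = rank S) : φ ≠ 0 := by
  rintro rfl
  have : F = S := le_antisymm hF fun u hu => (h.mem_iff ⟨u, le_md S hu⟩).2 ⟨rfl, hu⟩
  rw [this] at hr
  omega

theorem IsNormalOn.isStdNormal {φ : md S →ₗ[ℤ[X]] ℤ[X]} (h : IsNormalOn S F φ) (hF : F ≤ S)
    (hr : rank F + 1 = rank S) : IsStdNormal S F φ where
  mem_iff ψ := by
    constructor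
    · intro hψ
      obtain ⟨c, rfl⟩ := h.gen ψ fun w hw => ((hψ w).1 hw).1
      refine ⟨c, ?_, rfl⟩
      rintro rfl
      have : F = S := le_antisymm hF fun u hu => (hψ ⟨u, le_md S hu⟩).2 ⟨by simp, hu⟩
      rw [this] at hr
      omega
    · rintro ⟨c, hc, rfl⟩ u
      rw [h.mem_iff, LinearMap.smul_apply, smul_eq_mul, mul_eq_zero, or_iff_right hc]
  nonneg u hu := isNonneg_iff.2 (h.nonneg u hu)

theorem isNormalOn_stdNormal [Module.Free ℤ[X] (md S)] (F : Facet S) :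
    IsNormalOn S F.1 (stdNormal S F) := by
  obtain ⟨φ, hφ⟩ := exists_isNormalOn F.2.1 F.2.2
  have hex : ∃ φ, IsStdNormal S F.1 φ := ⟨φ, hφ.isStdNormal F.2.1.le F.2.2⟩
  have hs : IsStdNormal S F.1 (stdNormal S F) := by
    unfold stdNormal
    rw [dif_pos hex]
    exact hex.choose_spec
  refine ⟨fun u hu => isNonneg_iff.1 (hs.nonneg u hu), ?_, fun ψ hψ => ?_⟩
  · exact (hs.mem_iff _).2 ⟨1, one_ne_zero, (one_smul _ _).symm⟩
  · obtain ⟨c, rfl⟩ := hφ.gen ψ hψ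
    obtain ⟨d, -, rfl⟩ := (hs.mem_iff φ).1 hφ.mem_iff
    exact ⟨c * d, smul_smul _ _ _⟩

/-- The standard normal vector of a facet, as a functional on a lattice that equals `S^md`. -/
noncomputable def normalOn (S : Semi n) (F : Facet S) {L : Submodule ℤ[X] (Amb n)} (h : md S = L) :
    L →ₗ[ℤ[X]] ℤ[X] :=
  (stdNormal S F).comp (LinearEquiv.ofEq _ _ h.symm).toLinearMap

theorem isNormalOn_normalOn {L : Submodule ℤ[X] (Amb n)} [Module.Free ℤ[X] L] (F : Facet S)
    (h : md S = L) : IsNormalOn S F.1 (normalOn S F h) := by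
  subst h
  exact isNormalOn_stdNormal F

theorem normalOn_ne_zero {L : Submodule ℤ[X] (Amb n)} [Module.Free ℤ[X] L] (F : Facet S)
    (h : md S = L) : normalOn S F h ≠ 0 := by
  subst h
  exact (isNormalOn_stdNormal F).ne_zero F.2.1.le F.2.2

/-- Faces with the same lattice have the same annihilator, so the two generators differ by a unit of
`ℤ[x]`; nonnegativity on `S` excludes `-1`. -/
theorem IsNormalOn.eq_of_md_eq {L : Submodule ℤ[X] (Amb n)} {φ ψ : L →ₗ[ℤ[X]] ℤ[X]}
    (hφ : IsNormalOn S F φ) (hψ : IsNormalOn T H ψ) (hS : md S = L) (hF : F ≤ S) (hST : S ≤ T)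
    (h : md F = md H) (h0 : φ ≠ 0) : φ = ψ := by
  subst hS
  obtain ⟨c, hc⟩ := hψ.gen φ fun w hw => map_eq_zero_of_mem_md (md_mono hF)
    (fun w hw => ((hφ.mem_iff w).1 hw).1) w (h ▸ le_md H hw)
  obtain ⟨d, hd⟩ := hφ.gen ψ fun w hw => map_eq_zero_of_mem_md (h ▸ md_mono hF)
    (fun w hw => ((hψ.mem_iff w).1 hw).1) w (h ▸ le_md F hw)
  obtain ⟨u, hu, hne⟩ := exists_mem_ne_zero h0
  have h1 : 0 < φ u := lt_of_le_of_ne (hφ.nonneg u hu) hne.symm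
  have h2 : φ u = c * ψ u := LinearMap.congr_fun hc u
  have h3 : ψ u = d * φ u := LinearMap.congr_fun hd u
  have hcd : c * d = 1 := by
    apply mul_right_cancel₀ hne
    rw [mul_assoc, ← h3, ← h2, one_mul]
  have hc0 : 0 < c := pos_of_mul_pos_left (h2 ▸ h1) (hψ.nonneg u (hST hu))
  rw [hc, eq_one_of_pos_of_isUnit hc0 (IsUnit.of_mul_eq_one _ hcd), one_smul]

/-- The face of `S` cut out by a functional that is nonnegative on `S`. -/
noncomputable def kerFace (S : Semi n) (φ : md S →ₗ[ℤ[X]] ℤ[X]) : Semi n :=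
  S ⊓ ((LinearMap.ker φ).map (md S).subtype).restrictScalars PX

theorem mem_kerFace {φ : md S →ₗ[ℤ[X]] ℤ[X]} (u : md S) :
    (u : Amb n) ∈ kerFace S φ ↔ (u : Amb n) ∈ S ∧ φ u = 0 := by
  refine and_congr Iff.rfl ?_
  constructor
  · rintro ⟨w, hw, e⟩
    rw [← Subtype.ext e]
    exact hw
  · exact fun h => ⟨u, h, rfl⟩

theorem isFace_kerFace {φ : md S →ₗ[ℤ[X]] ℤ[X]} (h : ∀ u : md S, (u : Amb n) ∈ S → 0 ≤ φ u) :
    IsFace S (kerFace S φ) where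
  le := inf_le_left
  add_mem u hu v hv huv := by
    have h1 := ((mem_kerFace (⟨u, le_md S hu⟩ + ⟨v, le_md S hv⟩)).1 huv).2
    rw [map_add] at h1
    have h2 := h ⟨u, le_md S hu⟩ hu
    have h3 := h ⟨v, le_md S hv⟩ hv
    exact ⟨(mem_kerFace ⟨u, le_md S hu⟩).2 ⟨hu, by linarith⟩,
      (mem_kerFace ⟨v, le_md S hv⟩).2 ⟨hv, by linarith⟩⟩
  smul_mem g hg u hu hgu := by
    have h1 := ((mem_kerFace ((g : ℤ[X]) • (⟨u, le_md S hu⟩ : md S))).1 hgu).2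
    rw [map_smul, smul_eq_mul] at h1
    have hg' : (g : ℤ[X]) ≠ 0 := mt ZeroMemClass.coe_eq_zero.1 hg
    exact (mem_kerFace ⟨u, le_md S hu⟩).2 ⟨hu, (mul_eq_zero.1 h1).resolve_left hg'⟩

theorem rank_kerFace {φ : md S →ₗ[ℤ[X]] ℤ[X]} (h0 : φ ≠ 0) {W : Submodule ℤ[X] (md S)}
    (hW : W ≤ (md (kerFace S φ)).submoduleOf (md S))
    (hr : Module.finrank ℤ[X] W + 1 = rank S) : rank (kerFace S φ) + 1 = rank S := by
  have hle : kerFace S φ ≤ S := inf_le_left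
  rw [← finrank_submoduleOf_md hle]
  have h1 := Submodule.finrank_mono hW
  obtain ⟨u, hu⟩ := DFunLike.ne_iff.1 h0
  have h2 : Module.finrank ℤ[X] ((md (kerFace S φ)).submoduleOf (md S)) < rank S := by
    refine finrank_lt_of_not_torsion (u := u) fun c hc => ?_
    have := map_eq_zero_of_mem_md (md_mono hle)
      (fun w hw => ((mem_kerFace w).1 hw).2) (c • u) hc
    rw [map_smul, smul_eq_mul] at this
    exact (mul_eq_zero.1 this).resolve_right hu
  omega

theorem nonneg_of_nonneg_generators {U : Set (Amb n)} (hU : Submodule.span PX U = S)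
    {ψ : md S →ₗ[ℤ[X]] ℤ[X]} (hψ : ∀ u : md S, (u : Amb n) ∈ U → 0 ≤ ψ u) (u : md S)
    (hu : (u : Amb n) ∈ S) : 0 ≤ ψ u := by
  have key : ∀ x ∈ Submodule.span PX U, ∀ w : md S, (w : Amb n) = x → 0 ≤ ψ w := by
    intro x hx
    induction hx using Submodule.span_induction with
    | mem x hx => exact fun w hw => hψ w (hw ▸ hx)
    | zero =>
      intro w hw
      rw [show w = 0 from Subtype.ext hw, map_zero]
    | add x y hx hy ihx ihy =>
      intro w hw
      have e : w = ⟨x, le_md S (hU ▸ hx)⟩ + ⟨y, le_md S (hU ▸ hy)⟩ := Subtype.ext hw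
      rw [e, map_add]
      exact add_nonneg (ihx _ rfl) (ihy _ rfl)
    | smul c x hx ih =>
      intro w hw
      have e : w = (c : ℤ[X]) • ⟨x, le_md S (hU ▸ hx)⟩ := Subtype.ext hw
      rw [e, map_smul, smul_eq_mul]
      exact mul_nonneg (isNonneg_iff.1 c.2) (ih _ rfl)
  exact key u (hU.symm ▸ hu) u rfl

theorem span_generators_eq_top {U : Set (Amb n)} (hU : Submodule.span PX U = S) :
    Submodule.span ℤ[X] {u : md S | (u : Amb n) ∈ U} = ⊤ := by
  have h : md S = Submodule.span ℤ[X] U := by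
    refine le_antisymm (Submodule.span_le.2 ?_) (Submodule.span_mono (hU ▸ Submodule.subset_span))
    rw [← hU]
    exact Submodule.span_subset_span PX ℤ[X] U
  rw [h]
  exact Submodule.span_setOfPred_mem_eq_top

/-- If a functional is nonnegative on `S` and does not vanish at `v`, then some facet normal does not
vanish at `v`. -/
theorem exists_stdNormal_ne_zero [Module.Free ℤ[X] (md S)] (hS : S.FG) {φ : md S →ₗ[ℤ[X]] ℤ[X]}
    (h : ∀ u : md S, (u : Amb n) ∈ S → 0 ≤ φ u) {v : md S} (hv : φ v ≠ 0) :
    ∃ F : Facet S, stdNormal S F v ≠ 0 := by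
  classical
  wlog hneg : φ v < 0 generalizing v
  · have hpos : φ (-v) < 0 := by
      rw [map_neg, Left.neg_neg_iff]
      exact lt_of_le_of_ne (not_lt.1 hneg) hv.symm
    obtain ⟨F, hF⟩ := this hpos.ne hpos
    exact ⟨F, by simpa using hF⟩
  obtain ⟨U, hU⟩ := hS
  have hUS : ∀ u ∈ U, u ∈ S := fun u hu => hU ▸ Submodule.subset_span hu
  let U' : Finset (md S) := U.subtype (· ∈ md S)
  have hspan : Submodule.span ℤ[X] (U' : Set (md S)) = ⊤ := by
    rw [← span_generators_eq_top hU]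
    congr 1
    ext u
    simp [U']
  obtain ⟨ψ, hψU, hψv, hψr⟩ := exists_facet_functional U' hspan v φ
    (fun u hu => h u (hUS _ (by simpa [U'] using hu))) hneg
  have hψS : ∀ u : md S, (u : Amb n) ∈ S → 0 ≤ ψ u :=
    nonneg_of_nonneg_generators hU fun u hu => hψU u (by simpa [U'] using hu)
  have hψ0 : ψ ≠ 0 := fun h0 => by simp [h0] at hψv
  have hface := isFace_kerFace hψS
  let F : Facet S := ⟨kerFace S ψ, hface, rank_kerFace hψ0 (Submodule.span_le.2 fun u hu =>
    le_md _ ((mem_kerFace u).2 ⟨hUS _ (by simpa [U'] using hu.1), hu.2⟩)) hψr⟩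
  refine ⟨F, fun h0 => ?_⟩
  -- `ψ` vanishes on its own face, so it is a multiple of the facet normal and would vanish at `v`
  -- too.
  obtain ⟨c, hc⟩ := (isNormalOn_stdNormal F).gen ψ fun w hw => ((mem_kerFace w).1 hw).2
  rw [hc, LinearMap.smul_apply, h0, smul_zero] at hψv
  exact hψv.false

/-- The facet normals of a pointed affine semimodule separate the points of its lattice. -/
theorem eq_zero_of_forall_stdNormal [Module.Free ℤ[X] (md S)] (hS : S.FG) (hp : IsPointed S)
    (v : md S) (hv : ∀ F : Facet S, stdNormal S F v = 0) : v = 0 := by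
  classical
  by_contra hv0
  obtain ⟨U, hU⟩ := id hS
  have hUS : ∀ u ∈ U, u ∈ S := fun u hu => hU ▸ Submodule.subset_span hu
  let U' : Finset (md S) := (U.subtype (· ∈ md S)).filter (· ≠ 0)
  have hU' : ∀ u : md S, u ∈ U' ↔ (u : Amb n) ∈ U ∧ u ≠ 0 := fun u => by
    simp only [U', Finset.mem_filter, Finset.mem_subtype]
  have hnn : ∀ ψ : md S →ₗ[ℤ[X]] ℤ[X], (∀ u ∈ U', 0 < ψ u) →
      ∀ u : md S, (u : Amb n) ∈ S → 0 ≤ ψ u := fun ψ hψ =>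
    nonneg_of_nonneg_generators hU fun u hu => by
      rcases eq_or_ne u 0 with rfl | h
      · exact (map_zero ψ).ge
      · exact (hψ u ((hU' u).2 ⟨hu, h⟩)).le
  -- A nonnegative relation puts `c u • u` and its negative in `S`, so pointedness kills `c u`. The
  -- generator `0` was removed from `U'` because no functional is positive there.
  obtain ⟨φ, -, hφ⟩ := exists_functional_pos_of_no_relation U' ⊥ (by
    intro c hc hsum u hu
    rw [Submodule.mem_bot, ← Finset.add_sum_erase _ _ hu] at hsum
    have h1 : c u • (u : Amb n) ∈ S := smul_mem_of_nonneg S (hc u hu) (hUS _ ((hU' u).1 hu).1)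
    have h2 : ((∑ w ∈ U'.erase u, c w • w : md S) : Amb n) ∈ S := by
      rw [AddSubmonoidClass.coe_finsetSum]
      exact S.sum_mem fun w hw => smul_mem_of_nonneg S (hc w (Finset.mem_of_mem_erase hw))
        (hUS _ ((hU' w).1 (Finset.mem_of_mem_erase hw)).1)
    have h3 : c u • (u : Amb n) = 0 := by
      refine hp _ h1 ?_
      have := congrArg Subtype.val (eq_neg_of_add_eq_zero_right hsum)
      rw [this] at h2
      exact h2
    exact (smul_eq_zero.1 h3).resolve_right fun h => ((hU' u).1 hu).2 (Subtype.ext h))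
  by_cases h : φ v = 0
  · obtain ⟨ψ, -, hψ⟩ := exists_functional_ne_zero (⊥ : Submodule ℤ[X] (md S)) v fun c hc =>
      (smul_eq_zero.1 ((Submodule.mem_bot _).1 hc)).resolve_right hv0
    obtain ⟨a, b, hb, hab⟩ := exists_perturbation_pos U' φ ψ hφ
    obtain ⟨F, hF⟩ := exists_stdNormal_ne_zero hS (hnn _ hab) (v := v)
      (by simpa [h] using ⟨hb.ne', hψ⟩)
    exact hF (hv F)
  · obtain ⟨F, hF⟩ := exists_stdNormal_ne_zero hS (hnn _ hφ) h
    exact hF (hv F)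

end Normals

/-! ### Adjoining inverses to semimodules, and smoothness via dual vectors -/

section Lattice

variable {n : ℕ} {S T F : Semi n} {u : Amb n}

theorem mem_adj_iff {x : Amb n} : x ∈ adj S u ↔ ∃ s ∈ S, ∃ c : ℤ[X], x = s + c • u := by
  unfold adj
  rw [Submodule.mem_sup]
  constructor
  · rintro ⟨s, hs, y, hy, rfl⟩
    obtain ⟨c, rfl⟩ := Submodule.mem_span_singleton.1 hy
    exact ⟨s, hs, c, rfl⟩
  · rintro ⟨s, hs, c, rfl⟩
    exact ⟨s, hs, c • u, Submodule.mem_span_singleton.2 ⟨c, rfl⟩, rfl⟩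

theorem smul_mem_adj (S : Semi n) (u : Amb n) (c : ℤ[X]) : c • u ∈ adj S u :=
  mem_adj_iff.2 ⟨0, S.zero_mem, c, (zero_add _).symm⟩

theorem mem_adj_self (S : Semi n) (u : Amb n) : u ∈ adj S u := by
  simpa using smul_mem_adj S u 1

theorem md_adj (hu : u ∈ md S) : md (adj S u) = md S := by
  refine le_antisymm (Submodule.span_le.2 fun x hx => ?_) (md_mono (le_adj S u))
  obtain ⟨s, hs, c, rfl⟩ := mem_adj_iff.1 hx
  exact add_mem (le_md S hs) (Submodule.smul_mem _ c hu)

theorem Glue.symm {u : Amb n} (h : Glue S T u) : Glue T S (-u) where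
  mem_left := h.mem_right
  mem_right := by simpa using h.mem_left
  eq := by rw [neg_neg, h.eq]

theorem glue_zero (S : Semi n) : Glue S S 0 := ⟨S.zero_mem, by simp, by simp⟩

/-- Adjoining the inverse of an element `-u` of a face `F` turns it into a face. -/
theorem IsFace.adj (hF : IsFace S F) (hu : -u ∈ F) : IsFace (adj S u) (adj F u) where
  le := sup_le_sup_right hF.le _
  add_mem := by
    -- Only `-u` lies in `F`: for `m ≤ 0` the term `m • u` is absorbed into `e`, for `m ≥ 0` it is
    -- moved to the side of `t`.
    have key : ∀ s ∈ S, ∀ t ∈ S, ∀ e ∈ F, ∀ m : ℤ[X], s + t = e + m • u → s ∈ F := by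
      intro s hs t ht e he m h
      rcases le_total m 0 with hm | hm
      · refine (hF.add_mem s hs t ht ?_).1
        rw [h, ← neg_smul_neg]
        exact F.add_mem he (smul_mem_of_nonneg F (by simpa using hm) hu)
      · have h1 : m • -u ∈ F := smul_mem_of_nonneg F hm hu
        refine (hF.add_mem s hs (t + m • -u) (S.add_mem ht (hF.le h1)) ?_).1
        have : s + (t + m • -u) = e := by
          rw [← add_assoc, h]
          module
        rwa [this]
    intro x hx y hy hxy
    obtain ⟨s, hs, c, rfl⟩ := mem_adj_iff.1 hx
    obtain ⟨t, ht, d, rfl⟩ := mem_adj_iff.1 hy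
    obtain ⟨e, he, m, h⟩ := mem_adj_iff.1 hxy
    have h' : s + t = e + (m - c - d) • u := by
      calc s + t = (s + c • u + (t + d • u)) - c • u - d • u := by abel
        _ = _ := by rw [h]; module
    exact ⟨mem_adj_iff.2 ⟨s, key s hs t ht e he _ h', c, rfl⟩,
      mem_adj_iff.2 ⟨t, key t ht s hs e he _ (by rw [add_comm, h']), d, rfl⟩⟩
  smul_mem := by
    intro g hg x hx hgx
    obtain ⟨s, hs, c, rfl⟩ := mem_adj_iff.1 hx
    obtain ⟨e, he, m, h⟩ := mem_adj_iff.1 hgx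
    refine mem_adj_iff.2 ⟨s, ?_, c, rfl⟩
    have h' : (g : ℤ[X]) • s = e + (m - g * c) • u := by
      have h2 : (g : ℤ[X]) • (s + c • u) = e + m • u := h
      calc (g : ℤ[X]) • s = (g : ℤ[X]) • (s + c • u) - ((g : ℤ[X]) * c) • u := by module
        _ = _ := by rw [h2]; module
    have hgs : (g : ℤ[X]) • s ∈ S := S.smul_mem g hs
    rcases le_total (m - g * c) 0 with hm | hm
    · refine hF.smul_mem g hg s hs ?_
      change (g : ℤ[X]) • s ∈ F
      rw [h', ← neg_smul_neg]
      exact F.add_mem he (smul_mem_of_nonneg F (by simpa using hm) hu)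
    · have h1 : (m - g * c) • -u ∈ F := smul_mem_of_nonneg F hm hu
      refine hF.smul_mem g hg s hs (hF.add_mem _ hgs _ (hF.le h1) ?_).1
      rw [h']
      convert he using 1
      module

theorem IsFace.inf {H : Semi n} (hH : IsFace T H) (h : S ≤ T) : IsFace S (H ⊓ S) where
  le := inf_le_right
  add_mem u hu v hv huv :=
    have h1 := hH.add_mem u (h hu) v (h hv) huv.1
    ⟨⟨h1.1, hu⟩, ⟨h1.2, hv⟩⟩
  smul_mem g hg u hu hgu := ⟨hH.smul_mem g hg u (h hu) hgu.1, hu⟩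

/-- Facet normals that form a basis take arbitrary prescribed values. -/
theorem IsSmooth.exists_normalOn_eq {L : Submodule ℤ[X] (Amb n)} [Module.Free ℤ[X] L]
    (hS : IsSmooth S) (h : md S = L) (a : Facet S → ℤ[X]) :
    ∃ u : L, ∀ F, normalOn S F h u = a F := by
  subst h
  let b := Module.Basis.mk hS.1 hS.2.ge
  -- The values `a` define a functional on the dual, which by reflexivity is evaluation at a lattice
  -- vector.
  refine ⟨(Module.evalEquiv ℤ[X] (md S)).symm (b.constr ℤ[X] a), fun F => ?_⟩
  have h1 : b F = stdNormal S F := Module.Basis.mk_apply _ _ F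
  have h2 : b.constr ℤ[X] a (stdNormal S F) = a F := by rw [← h1, b.constr_basis]
  rw [← h2]
  exact Module.apply_evalEquiv_symm_apply ..

/-- Vectors `w_F` dual to the normals give independence at once. As the normals separate points, `v
= ∑ φ_F(v) w_F`, so every `ψ` equals `∑ ψ(w_F) φ_F`. -/
theorem isSmooth_of_exists_dual [Module.Free ℤ[X] (md S)] (hS : S.FG) (hp : IsPointed S)
    (h : ∀ a : Facet S → ℤ[X], ∃ u : md S, ∀ F, stdNormal S F u = a F) : IsSmooth S := by
  classical
  have := finite_facet hS
  have := Fintype.ofFinite (Facet S)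
  choose w hw using fun G : Facet S => h (Pi.single G 1)
  constructor
  · rw [Fintype.linearIndependent_iff]
    intro c hc G
    have := LinearMap.congr_fun hc (w G)
    simpa [LinearMap.sum_apply, hw, Pi.single_apply] using this
  · rw [eq_top_iff]
    intro ψ _
    have hψ : ψ = ∑ F, ψ (w F) • stdNormal S F := by
      ext v
      have h0 : v - ∑ F, stdNormal S F v • w F = 0 :=
        eq_zero_of_forall_stdNormal hS hp _ fun G => by
          simp [map_sum, hw, Pi.single_apply]
      have h1 := congrArg ψ (sub_eq_zero.1 h0)
      rw [h1]
      simp [map_sum, LinearMap.sum_apply, mul_comm]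
    rw [hψ]
    exact Submodule.sum_mem _ fun F _ => Submodule.smul_mem _ _ (Submodule.subset_span ⟨F, rfl⟩)

end Lattice

/-! ### Equivalence of facets in a fan -/

namespace Fan

variable {n : ℕ} {ι : Type*} [Finite ι] (A : Fan n ι)

/-- The standard normal vector of a facet of a member of the fan, as a functional on `Σ^md`. -/
noncomputable def facetNormal (F : A.Facets) : A.lattice →ₗ[ℤ[X]] ℤ[X] :=
  normalOn (A.S F.1) F.2 (A.md_eq F.1)

theorem md_adj_eq (i : ι) {u : Amb n} (hu : u ∈ A.lattice) : md (adj (A.S i) u) = A.lattice := by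
  rw [md_adj ((A.md_eq i).symm ▸ hu), A.md_eq]

theorem rank_eq (i j : ι) : rank (A.S i) = rank (A.S j) := by
  unfold rank
  rw [A.md_eq, A.md_eq]

theorem mem_lattice {i : ι} {u : Amb n} (hu : u ∈ A.S i) : u ∈ A.lattice :=
  A.md_eq i ▸ le_md _ hu

section Normal

variable [Module.Free ℤ[X] A.lattice]

/-- The face `H` has the rank of a facet of the overlap semimodule, so both normals equal the normal
of `H`. -/
theorem facetNormal_eq_of_facetRel {F G : A.Facets} (h : A.FacetRel F G) :
    A.facetNormal F = A.facetNormal G := by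
  obtain ⟨u, hu, H, hH, hFG, hGH⟩ := h
  have hT : md (adj (A.S F.1) (-u)) = A.lattice :=
    A.md_adj_eq _ (neg_mem (A.mem_lattice hu.mem_left))
  have hr : rank H + 1 = rank (adj (A.S F.1) (-u)) := by
    have h1 : rank H = rank F.2.1 := by
      unfold rank
      rw [hFG, hGH]
    have h2 : rank (adj (A.S F.1) (-u)) = rank (A.S F.1) := by
      unfold rank
      rw [hT, A.md_eq]
    rw [h1, h2]
    exact F.2.2.2
  have hH' := isNormalOn_normalOn (⟨H, hH, hr⟩ : Facet (adj (A.S F.1) (-u))) hT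
  rw [facetNormal, facetNormal,
    (isNormalOn_normalOn F.2 (A.md_eq F.1)).eq_of_md_eq hH' (A.md_eq F.1) F.2.2.1.le
      (le_adj _ _) (hFG.trans hGH) (normalOn_ne_zero _ _),
    (isNormalOn_normalOn G.2 (A.md_eq G.1)).eq_of_md_eq hH' (A.md_eq G.1) G.2.2.1.le
      hu.le_right hGH (normalOn_ne_zero _ _)]

theorem rayNormal_mk (F : A.Facets) : A.rayNormal (Quot.mk _ F) = A.facetNormal F := by
  let f : A.Rays → (A.lattice →ₗ[ℤ[X]] ℤ[X]) :=
    Quot.lift A.facetNormal fun _ _ h => A.facetNormal_eq_of_facetRel h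
  change f (Quot.mk _ (Quot.out (Quot.mk A.FacetRel F))) = f (Quot.mk _ F)
  rw [Quot.out_eq]

/-- Different facets of the same member of the fan are not equivalent. -/
theorem facet_eq_of_mk_eq {i : ι} {F G : Facet (A.S i)}
    (h : Quot.mk A.FacetRel ⟨i, F⟩ = Quot.mk A.FacetRel ⟨i, G⟩) : F = G := by
  have h1 : A.facetNormal ⟨i, F⟩ = A.facetNormal ⟨i, G⟩ :=
    (A.rayNormal_mk ⟨i, F⟩).symm.trans ((congrArg A.rayNormal h).trans (A.rayNormal_mk ⟨i, G⟩))
  have hF := isNormalOn_normalOn F (A.md_eq i)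
  have hG := isNormalOn_normalOn G (A.md_eq i)
  have h2 : normalOn (A.S i) F (A.md_eq i) = normalOn (A.S i) G (A.md_eq i) := h1
  apply Subtype.ext
  ext u
  constructor
  · intro hu
    have := (hF.mem_iff ⟨u, A.mem_lattice (F.2.1.le hu)⟩).1 hu
    rw [h2] at this
    exact (hG.mem_iff _).2 this
  · intro hu
    have := (hG.mem_iff ⟨u, A.mem_lattice (G.2.1.le hu)⟩).1 hu
    rw [← h2] at this
    exact (hF.mem_iff _).2 this

end Normal

/-- A facet of `S_j` that contains `-u` is equivalent to a facet of `S_i`. -/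
theorem exists_facetRel {i j : ι} {u : Amb n} (hu : Glue (A.S i) (A.S j) u) (F : Facet (A.S j))
    (hF : -u ∈ F.1) : ∃ G : Facet (A.S i), A.FacetRel ⟨i, G⟩ ⟨j, F⟩ := by
  -- Extend `F` to the overlap `S_j + ℤ[x]u = S_i + ℤ[x](-u)` and intersect with `S_i`. The lattice
  -- is not changed, since `u` itself lies in the intersection.
  have hH : IsFace (adj (A.S i) (-u)) (adj F.1 u) := hu.eq ▸ F.2.1.adj hF
  have huF : u ∈ md F.1 := by simpa using neg_mem (le_md _ hF)
  have hHF : md (adj F.1 u) = md F.1 := md_adj huF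
  have hG := hH.inf (le_adj (A.S i) (-u))
  have hGH : md (adj F.1 u ⊓ A.S i) = md F.1 := by
    rw [← hHF]
    refine le_antisymm (md_mono inf_le_left) (Submodule.span_le.2 fun x hx => ?_)
    obtain ⟨s, hs, c, rfl⟩ := mem_adj_iff.1 (hH.le hx)
    have huG : u ∈ adj F.1 u ⊓ A.S i := ⟨mem_adj_self _ _, hu.mem_left⟩
    have hsH : s ∈ adj F.1 u := by
      obtain ⟨e, he, d, h⟩ := mem_adj_iff.1 hx
      refine mem_adj_iff.2 ⟨e, he, d + c, ?_⟩
      rw [add_smul, ← add_assoc, ← h]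
      module
    exact add_mem (le_md _ ⟨hsH, hs⟩) (Submodule.smul_mem _ c (neg_mem (le_md _ huG)))
  refine ⟨⟨_, hG, ?_⟩, u, hu, adj F.1 u, hH, hGH, hHF.symm⟩
  have h1 : rank (adj F.1 u ⊓ A.S i) = rank F.1 := by
    unfold rank
    rw [hGH]
  rw [A.rank_eq i j, h1]
  exact F.2.2

end Fan

/-! ### Characters at points of the affine pieces, and the origin -/

section Characters

variable {n : ℕ} {k : Type*} [Field k] (σ : k →+* k) {S T : Semi n}

theorem chi_mul (u v : S) : chi k u * chi k v = chi k (u + v) := by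
  simp [chi]

theorem incl_chi (h : S ≤ T) (u : S) : incl k h (chi k u) = chi k ⟨u, h u.2⟩ := by
  simp only [incl, chi, AddMonoidAlgebra.mapDomainRingHom_apply, AddMonoidAlgebra.mapDomain_single]
  rfl

theorem sig_single (u : S) (c : k) :
    sig σ S (AddMonoidAlgebra.single u c) = AddMonoidAlgebra.single (xP • u) (σ c) := by
  simp only [sig, RingHom.comp_apply, AddMonoidAlgebra.mapRingHom_single,
    AddMonoidAlgebra.mapDomainRingHom_apply, AddMonoidAlgebra.mapDomain_single]
  rfl

theorem iterate_sig_chi (u : S) (m : ℕ) : (sig σ S)^[m] (chi k u) = chi k (xP ^ m • u) := by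
  induction m with
  | zero => simp
  | succ m ih =>
    rw [Function.iterate_succ_apply', ih, chi, sig_single, map_one, smul_smul, ← pow_succ']
    rfl

theorem le_X_pow (g : ℤ[X]) : ∃ m : ℕ, g ≤ X ^ m := by
  refine ⟨g.natDegree + 1, ?_⟩
  change 0 ≤ (X ^ (g.natDegree + 1) - g).leadingCoeff
  rw [leadingCoeff_sub_of_degree_lt]
  · simp
  · rw [degree_X_pow]
    exact degree_le_natDegree.trans_lt (by exact_mod_cast Nat.lt_succ_self _)

variable {σ}

/-- The set of characters that do not vanish at a point is closed under positive multiples. -/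
theorem IsPSigmaPrime.chi_smul_notMem {I : Ideal (Alg k S)} (hI : IsPSigmaPrime σ I) {u : S}
    (hu : chi k u ∉ I) (g : PX) : chi k (g • u) ∉ I := by
  intro h
  obtain ⟨m, hm⟩ := le_X_pow (g : ℤ[X])
  let g' : PX := ⟨X ^ m - (g : ℤ[X]), isNonneg_iff.2 (sub_nonneg.2 hm)⟩
  have e : xP ^ m = g + g' := Subtype.ext (by
    change (X : ℤ[X]) ^ m = (g : ℤ[X]) + (X ^ m - (g : ℤ[X]))
    ring)
  -- `χ^{gu}` divides `χ^{x^m u} = σ^m(χ^u)`, so if it were in `I`, perfectness would put `χ^u`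
  -- there as well.
  refine hu (hI.perfect (X ^ m) (chi k u) (pow_ne_zero m X_ne_zero) ?_)
  rw [support_X_pow, Finset.prod_singleton, coeff_X_pow_self, pow_one, iterate_sig_chi, e, add_smul,
    ← chi_mul]
  exact I.mul_mem_right _ h

/-- If `b` becomes invertible once `a` is inverted, then `χ^b` divides some `χ^{ga}` with `g ∈
P[x]`, which is nonzero at the point. -/
theorem IsPSigmaPrime.chi_notMem_of_mem_adj {I : Ideal (Alg k T)} (hI : IsPSigmaPrime σ I)
    {a b : Amb n} (ha : a ∈ T) (hb : b ∈ T) (h : -b ∈ adj T (-a)) (ha' : chi k ⟨a, ha⟩ ∉ I) :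
    chi k ⟨b, hb⟩ ∉ I := by
  obtain ⟨t, ht, c, hc⟩ := mem_adj_iff.1 h
  have hbt : b + t = c • a := by
    have : t = -b + c • a := by
      rw [hc]
      module
    rw [this, add_neg_cancel_left]
  have hprod : ∀ (s : Amb n) (hs : s ∈ T) (g : PX), b + s = (g : ℤ[X]) • a → chi k ⟨b, hb⟩ ∉ I := by
    intro s hs g hg hbI
    have := hI.chi_smul_notMem ha' g
    rw [show g • (⟨a, ha⟩ : T) = ⟨b, hb⟩ + ⟨s, hs⟩ from Subtype.ext hg.symm, ← chi_mul] at this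
    exact this (I.mul_mem_right _ hbI)
  rcases le_total 0 c with h0 | h0
  · exact hprod t ht ⟨c, isNonneg_iff.2 h0⟩ hbt
  -- For `c ≤ 0` the element `b` is already invertible in `T`, which is the case `g = 0`.
  · refine hprod (t + (-c) • a) (T.add_mem ht (smul_mem_of_nonneg T (by simpa using h0) ha)) 0 ?_
    rw [← add_assoc, hbt]
    simp

open Classical in
/-- The evaluation of `k[S]` at the origin, for a pointed `S`. -/
noncomputable def originHom (k : Type*) [Field k] (hS : IsPointed S) : Alg k S →ₐ[k] k :=
  AddMonoidAlgebra.lift k k S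
    { toFun := fun u => if u.toAdd = 0 then 1 else 0
      map_one' := by simp
      map_mul' := fun u v => by
        -- This is where pointedness makes the indicator of `0` multiplicative.
        have h : u.toAdd + v.toAdd = 0 ↔ u.toAdd = 0 ∧ v.toAdd = 0 := by
          constructor
          · intro h
            have h' : (u.toAdd : Amb n) + v.toAdd = 0 := congrArg Subtype.val h
            have hu : (u.toAdd : Amb n) = 0 := hS _ u.toAdd.2 (by
              rw [neg_eq_of_add_eq_zero_right h']
              exact v.toAdd.2)
            rw [hu, zero_add] at h'
            exact ⟨Subtype.ext hu, Subtype.ext h'⟩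
          · rintro ⟨h1, h2⟩
            rw [h1, h2, add_zero]
        rw [toAdd_mul, ite_zero_mul_ite_zero, mul_one]
        exact if_congr h rfl rfl }

open Classical in
theorem originHom_single (hS : IsPointed S) (u : S) (c : k) :
    originHom k hS (AddMonoidAlgebra.single u c) = if u = 0 then c else 0 := by
  rw [originHom, AddMonoidAlgebra.lift_single]
  simp

theorem originHom_chi_of_ne_zero (hS : IsPointed S) {u : S} (hu : u ≠ 0) :
    originHom k hS (chi k u) = 0 := by
  classical
  rw [chi, originHom_single, if_neg hu]

theorem smul_ne_zero_of_ne_zero {g : PX} (hg : g ≠ 0) {u : S} (hu : u ≠ 0) : g • u ≠ 0 := by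
  intro h
  have h1 : (g : ℤ[X]) • (u : Amb n) = 0 := congrArg Subtype.val h
  rcases smul_eq_zero.1 h1 with h2 | h2
  · exact hg (ZeroMemClass.coe_eq_zero.1 h2)
  · exact hu (ZeroMemClass.coe_eq_zero.1 h2)

theorem originHom_sig (hS : IsPointed S) (f : Alg k S) :
    originHom k hS (sig σ S f) = σ (originHom k hS f) := by
  classical
  have hx : xP ≠ 0 := fun h => X_ne_zero (congrArg Subtype.val h : (X : ℤ[X]) = 0)
  have : (originHom k hS).toRingHom.comp (sig σ S) = σ.comp (originHom k hS).toRingHom := by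
    have key : ∀ (u : S) (c : k), originHom k hS (sig σ S (AddMonoidAlgebra.single u c)) =
        σ (originHom k hS (AddMonoidAlgebra.single u c)) := by
      intro u c
      rw [sig_single, originHom_single, originHom_single]
      rcases eq_or_ne u 0 with rfl | hu
      · rw [smul_zero, if_pos rfl, if_pos rfl]
      · rw [if_neg (smul_ne_zero_of_ne_zero hx hu), if_neg hu, map_zero]
    exact AddMonoidAlgebra.ringHom_ext (fun c => key 0 c) fun u => key u 1
  exact RingHom.congr_fun this f

theorem originHom_iterate_sig (hS : IsPointed S) (f : Alg k S) (m : ℕ) :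
    originHom k hS ((sig σ S)^[m] f) = σ^[m] (originHom k hS f) := by
  induction m with
  | zero => rfl
  | succ m ih => rw [Function.iterate_succ_apply', originHom_sig, ih, Function.iterate_succ_apply']

theorem isPSigmaPrime_ker_originHom (σ : k →+* k) (hS : IsPointed S) :
    IsPSigmaPrime σ (RingHom.ker (originHom k hS)) where
  prime := RingHom.ker_isPrime _
  sigma_mem a ha := by
    rw [RingHom.mem_ker] at ha ⊢
    rw [originHom_sig, ha, map_zero]
  perfect g a _ ha := by
    rw [RingHom.mem_ker, map_prod, Finset.prod_eq_zero_iff] at ha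
    obtain ⟨i, -, hi⟩ := ha
    rw [map_pow, originHom_iterate_sig] at hi
    have h1 := eq_zero_of_pow_eq_zero hi
    rw [RingHom.mem_ker]
    -- Some factor `σ^i` of the value of `a` at the origin is zero, and `σ` is injective on the
    -- field `k`.
    refine (σ.injective.iterate i) ?_
    rw [h1]
    exact (Function.iterate_fixed (map_zero σ) i).symm
  smul_mem g u f hg h := by
    rcases eq_or_ne u 0 with rfl | hu
    · rwa [smul_zero]
    · rw [RingHom.mem_ker, map_mul, originHom_chi_of_ne_zero hS (smul_ne_zero_of_ne_zero hg hu),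
        zero_mul]

/-- The origin of `Spec^{P[σ]}(k[S])`, for a pointed `S`. -/
noncomputable def origin (σ : k →+* k) (hS : IsPointed S) : PSpec σ S :=
  ⟨⟨RingHom.ker (originHom k hS), (isPSigmaPrime_ker_originHom σ hS).prime⟩,
    isPSigmaPrime_ker_originHom σ hS⟩

theorem origin_mem_faceVar (hS : IsPointed S) (F : Semi n) : origin σ hS ∈ faceVar σ S F := by
  intro u hu
  refine originHom_chi_of_ne_zero hS fun h => hu ?_
  rw [h]
  exact F.zero_mem

theorem isOpen_chi_notMem (u : S) : IsOpen {p : PSpec σ S | chi k u ∉ p.1.asIdeal} :=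
  (PrimeSpectrum.isOpen_basicOpen (a := chi k u)).preimage continuous_subtype_val

end Characters

/-! ### Open charts, Cartier divisors and the two implications -/

namespace Fan

variable {n : ℕ} {ι : Type*} [Finite ι] {k : Type*} [Field k] (σ : k →+* k) (A : Fan n ι)

/-- The part of the disjoint union of the affine pieces that is glued to the `i`-th piece. -/
def chartPreimage (i : ι) : Set (Σ j, PSpec σ (A.S j)) :=
  {q | ∃ (w : Amb n) (h : Glue (A.S q.1) (A.S i) w), chi k ⟨w, h.mem_left⟩ ∉ q.2.1.asIdeal}

variable {σ A} in
-- Membership in the `i`-th chart passes between the glued points `q` and `q'`: both are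
-- restrictions of `r` on the overlap `T`, where nonvanishing of characters can be compared.
theorem mem_chartPreimage_of_restriction {i j l : ι} {q : PSpec σ (A.S j)} {q' : PSpec σ (A.S l)}
    {T : Semi n} (hj : A.S j ≤ T) (hl : A.S l ≤ T) {v : Amb n} (hv : Glue (A.S j) (A.S l) v)
    (hT : T = adj (A.S j) (-v)) (r : PSpec σ T)
    (hq : q.1.asIdeal = r.1.asIdeal.comap (incl k hj))
    (hq' : q'.1.asIdeal = r.1.asIdeal.comap (incl k hl))
    (h : (⟨j, q⟩ : Σ j, PSpec σ (A.S j)) ∈ A.chartPreimage σ i) :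
    (⟨l, q'⟩ : Σ j, PSpec σ (A.S j)) ∈ A.chartPreimage σ i := by
  have hr := r.2
  have hmem : ∀ {w : Amb n} (hw : w ∈ A.S l), chi k ⟨w, hl hw⟩ ∉ r.1.asIdeal →
      chi k ⟨w, hw⟩ ∉ q'.1.asIdeal := fun hw h => by
    rw [hq', Ideal.mem_comap, incl_chi]
    exact h
  have hunit : ∀ {w : Amb n} (hw : w ∈ A.S l), -w ∈ T → chi k ⟨w, hl hw⟩ ∉ r.1.asIdeal :=
    fun {w} hw hw' => by
      refine hr.chi_notMem_of_mem_adj T.zero_mem _ (le_adj T _ hw') ?_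
      exact fun h1 => hr.prime.ne_top (Ideal.eq_top_iff_one _ |>.2 h1)
  obtain ⟨a, ha, haq⟩ := h
  have har : chi k ⟨a, hj ha.mem_left⟩ ∉ r.1.asIdeal := by
    rw [hq, Ideal.mem_comap, incl_chi] at haq
    exact haq
  rcases eq_or_ne l i with rfl | hli
  · exact ⟨0, glue_zero _, hmem (zero_mem _) (hunit (zero_mem _) (by simp))⟩
  rcases eq_or_ne j i with rfl | hji
  · refine ⟨-v, hv.symm, hmem hv.mem_right (hunit hv.mem_right ?_)⟩
    rw [neg_neg]
    exact hj hv.mem_left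
  rcases eq_or_ne j l with rfl | hjl
  · exact ⟨a, ha, hmem ha.mem_left har⟩
  · obtain ⟨w, hw⟩ := A.compat l i hli
    refine ⟨w, hw, hmem hw.mem_left
      (hr.chi_notMem_of_mem_adj (hj ha.mem_left) _ ?_ har)⟩
    -- The cocycle condition puts `-w` in `T + ℤ[x](-a)`, so `χ^w` is nonzero wherever `χ^a` is.
    have h1 := (A.cocycle i j l hji.symm hjl hli (-a) v w ha.symm hv hw).2
    have h2 : adj T (-a) = adj (adj (A.S j) (-a)) (-v) := by
      rw [hT]
      exact sup_right_comm _ _ _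
    rw [h2, h1]
    exact mem_adj_self _ _

theorem mem_chartPreimage_iff {i : ι} {p q : Σ j, PSpec σ (A.S j)} (h : A.GlueRel σ p q) :
    p ∈ A.chartPreimage σ i ↔ q ∈ A.chartPreimage σ i := by
  obtain ⟨u, hu, r, hp, hq⟩ := h
  constructor
  · exact mem_chartPreimage_of_restriction (le_adj _ _) hu.le_right hu rfl r hp hq
  · exact mem_chartPreimage_of_restriction hu.le_right (le_adj _ _) hu.symm
      (by rw [neg_neg, hu.eq]) r hq hp

/-- The image of the `i`-th chart. -/
def chartSet (i : ι) : Set (A.Var σ) :=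
  {P | Quot.lift (· ∈ A.chartPreimage σ i)
    (fun _ _ h => propext (A.mem_chartPreimage_iff σ h)) P}

theorem isOpen_chartSet (i : ι) : IsOpen (A.chartSet σ i) := by
  refine isQuotientMap_quot_mk.isOpen_preimage.1 ?_
  change IsOpen (A.chartPreimage σ i)
  rw [isOpen_sigma_iff]
  intro j
  have : Sigma.mk j ⁻¹' A.chartPreimage σ i = ⋃ (w : Amb n) (h : Glue (A.S j) (A.S i) w),
      {p : PSpec σ (A.S j) | chi k ⟨w, h.mem_left⟩ ∉ p.1.asIdeal} := by
    ext p
    simp [chartPreimage]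
  rw [this]
  exact isOpen_iUnion fun w => isOpen_iUnion fun h => isOpen_chi_notMem _

theorem chart_mem_chartSet (i : ι) (p : PSpec σ (A.S i)) : A.chart σ i p ∈ A.chartSet σ i :=
  ⟨0, glue_zero _, fun h => p.2.prime.ne_top ((Ideal.eq_top_iff_one _).2 h)⟩

theorem isCartier_of_isSmooth [Module.Free ℤ[X] A.lattice] (hA : A.IsSmooth) (D : A.Weil) :
    A.IsCartier σ D := by
  refine ⟨Set.range (A.chartSet σ), ?_, ?_, ?_⟩
  · rintro _ ⟨i, rfl⟩
    exact A.isOpen_chartSet σ i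
  · refine Set.eq_univ_of_forall fun P => ?_
    obtain ⟨⟨i, p⟩, rfl⟩ := Quot.exists_rep P
    exact ⟨_, ⟨i, rfl⟩, A.chart_mem_chartSet σ i p⟩
  · rintro _ ⟨i, rfl⟩
    let D' : A.Rays →₀ ℤ[X] := D
    obtain ⟨u, hu⟩ := (hA i).exists_normalOn_eq (A.md_eq i) fun F => D' (Quot.mk _ ⟨i, F⟩)
    refine ⟨u, ?_⟩
    ext1 ⟨L, hL⟩
    change D' L = A.rayNormal L u
    obtain ⟨P, ⟨⟨j, F⟩, rfl, p, hp, rfl⟩, w, hw, hwp⟩ := hL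
    -- A point of `D(F)` kills every character outside `F`, while `χ^w` is nonzero there because the
    -- point lies in the `i`-th chart.
    have hwF : w ∈ F.1 := by
      by_contra h
      exact hwp (hp _ h)
    obtain ⟨G, hG⟩ := A.exists_facetRel hw.symm F (by simpa using hwF)
    have e : Quot.mk A.FacetRel ⟨j, F⟩ = Quot.mk A.FacetRel ⟨i, G⟩ := (Quot.sound hG).symm
    calc D' (Quot.mk A.FacetRel ⟨j, F⟩) = D' (Quot.mk A.FacetRel ⟨i, G⟩) := congrArg D' e
      _ = A.facetNormal ⟨i, G⟩ u := (hu G).symm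
      _ = A.rayNormal (Quot.mk A.FacetRel ⟨i, G⟩) u :=
        (LinearMap.congr_fun (A.rayNormal_mk ⟨i, G⟩) u).symm
      _ = A.rayNormal (Quot.mk A.FacetRel ⟨j, F⟩) u := by rw [e]

theorem isSmooth_of_forall_isCartier [Module.Free ℤ[X] A.lattice]
    (hp : ∀ i, IsPointed (A.S i)) (h : ∀ D : A.Weil, A.IsCartier σ D) : A.IsSmooth := by
  classical
  intro i
  have hfree : Module.Free ℤ[X] (md (A.S i)) := by
    rw [A.md_eq i]
    infer_instance
  refine isSmooth_of_exists_dual (A.fg i) (hp i) fun a => ?_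
  -- Coefficients at classes without a facet of `S_i` are irrelevant; they are set to `0`.
  let f : A.Rays → ℤ[X] := fun L =>
    if h : ∃ F : Facet (A.S i), Quot.mk A.FacetRel ⟨i, F⟩ = L then a h.choose else 0
  have hf : ∀ F : Facet (A.S i), f (Quot.mk A.FacetRel ⟨i, F⟩) = a F := by
    intro F
    have hex : ∃ G : Facet (A.S i), Quot.mk A.FacetRel ⟨i, G⟩ = Quot.mk A.FacetRel ⟨i, F⟩ :=
      ⟨F, rfl⟩
    simp only [f]
    rw [dif_pos hex, A.facet_eq_of_mk_eq hex.choose_spec]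
  let D : A.Weil := Finsupp.equivFunOnFinite.symm f
  obtain ⟨C, -, hC, hCD⟩ := h D
  obtain ⟨U, hU, hmem⟩ : A.chart σ i (origin σ (hp i)) ∈ ⋃₀ C := hC ▸ Set.mem_univ _
  obtain ⟨u, hu⟩ := hCD U hU
  have hu' : (u : Amb n) ∈ md (A.S i) := by
    rw [A.md_eq i]
    exact u.2
  refine ⟨⟨u, hu'⟩, fun F => ?_⟩
  -- The origin witnesses that `U` meets the prime divisor of every facet of `S_i`, so one `u`
  -- serves all of them.
  have h1 := DFunLike.congr_fun hu ⟨Quot.mk A.FacetRel ⟨i, F⟩,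
    A.chart σ i (origin σ (hp i)), ⟨⟨i, F⟩, rfl, _, origin_mem_faceVar (hp i) _, rfl⟩, hmem⟩
  have h2 : f (Quot.mk A.FacetRel ⟨i, F⟩) = A.rayNormal (Quot.mk A.FacetRel ⟨i, F⟩) u := h1
  exact (LinearMap.congr_fun (A.rayNormal_mk ⟨i, F⟩) u).symm.trans (h2.symm.trans (hf F))

theorem isCartier_of_mem_charDivs {D : A.Weil} (hD : D ∈ A.charDivs) : A.IsCartier σ D := by
  obtain ⟨u, rfl⟩ := hD
  exact ⟨{Set.univ}, by simp, by simp, fun U _ => ⟨u, rfl⟩⟩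

theorem varIsSmooth_iff : A.VarIsSmooth σ ↔ ∀ D : A.Weil, A.IsCartier σ D := by
  constructor
  · intro h D
    obtain ⟨x, hx⟩ := h.2 (A.charDivs.mkQ D)
    obtain ⟨E, rfl⟩ := Submodule.mkQ_surjective _ x
    have hx' : A.charDivs.mkQ (E : A.Weil) = A.charDivs.mkQ D := hx
    -- `D` has the class of a Cartier divisor `E`; their difference is characteristic, hence
    -- Cartier.
    have h1 : D - E ∈ A.CDiv σ :=
      A.isCartier_of_mem_charDivs σ ((Submodule.Quotient.eq _).1 hx'.symm)
    have h2 := add_mem h1 E.2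
    rwa [sub_add_cancel] at h2
  · intro h
    constructor
    · rw [injective_iff_map_eq_zero]
      intro x hx
      obtain ⟨E, rfl⟩ := Submodule.mkQ_surjective _ x
      have hE : A.charDivs.mkQ (E : A.Weil) = 0 := hx
      have hE' : (E : A.Weil) ∈ A.charDivs := (Submodule.Quotient.mk_eq_zero _).1 hE
      exact (Submodule.Quotient.mk_eq_zero _).2 hE'
    · intro y
      obtain ⟨D, rfl⟩ := Submodule.mkQ_surjective _ y
      exact ⟨Submodule.mkQ _ ⟨D, h D⟩, rfl⟩

end Fan

end ToricP

theorem mainTheorem4 {k : Type*} [Field k] [CharZero k] (σ : k →+* k) {n : ℕ} {ι : Type*} [Finite ι]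
    (A : ToricP.Fan n ι) [Module.Free (Polynomial ℤ) A.lattice] :
    (A.IsSmooth → A.VarIsSmooth σ) ∧
      ((∀ i, ToricP.IsPointed (A.S i)) → (A.VarIsSmooth σ ↔ A.IsSmooth)) := by
  have h : A.IsSmooth → A.VarIsSmooth σ := fun hA =>
    (A.varIsSmooth_iff σ).2 fun D => A.isCartier_of_isSmooth σ hA D
  exact ⟨h, fun hp =>
    ⟨fun hX => A.isSmooth_of_forall_isCartier σ hp ((A.varIsSmooth_iff σ).1 hX), h⟩⟩
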